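/- Let $\mathcal T\subset\mathbb R^n$ be a nonempty closed set with compact boundary, and write $\mathbf d(x)$ for the distance of $x$ from $\mathcal T$. Let $f_0,f_1,\dots,f_m$ be vector fields that, for every bounded open $\Omega\subset\mathbb R^n$, are of class $C^1$ on $\Omega\setminus\mathcal T$ with $f_i$ and $Df_i$ bounded there. Consider the control system $$\dot y=f_0(y)+\sum_{i=1}^m a_if_i(y),\qquad y(0)=x\in\mathbb R^n\setminus\mathcal T,\qquad a\in A:=\{0,\pm e_1,\dots,\pm e_m\}.$$ With $[X,Y]=DY\cdot X-DX\cdot Y$ and $\chi$ the characteristic function of $\{f_0=0\}$, let $$\mathcal F^{(2)}=\{f_0,\ f_0-f_i,\ f_0+f_i\}\cup\{\pm[f_0,f_i]\chi,\ [f_j,f_\ell]\chi\}\quad(i,j,\ell=1,\dots,m),\qquad H^{(2)}(x,p)=\inf_{g\in\mathcal F^{(2)}}\langle p,g(x)\rangle .$$ A degree-$2$ control Lyapunov function is a continuous $U:\overline{\mathbb R^n\setminus\mathcal T}\to\mathbb R$ such that: $U>0$ on $\mathbb R^n\setminus\mathcal T$ and $U=0$ on $\partial\mathcal T$; $U^{-1}(K)$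 is compact for every compact $K\subset[0,\infty)$; for every compact $K\subset\mathbb R^n\setminus\mathcal T$ there is $\rho>0$ with $U(z_1)+U(z_2)-2U(\frac{z_1+z_2}2)\le\rho|z_1-z_2|^2$ whenever the segment $[z_1,z_2]$ lies in $K$; and $H^{(2)}(x,p)<0$ for all $x\in\mathbb R^n\setminus\mathcal T$ and all $p\in D^*U(x)$, where $D^*U(x)$ is the set of limits of $\nabla U(x_k)$ along sequences $x_k\to x$ of differentiability points $x_k\neq x$ of $U$ in $\mathbb R^n\setminus\mathcal T$. If a degree-$2$ control Lyapunov function exists, then the system is globally asymptotically controllable to $\mathcal T$. That is, there is a continuous $\beta:[0,\infty)^2\to[0,\infty)$ with $\beta(0,s)=0$ and $\beta(\cdot,s)$ strictly increasing and unbounded for each $s\ge0$, and with $\beta(\delta,\cdot)$ nonincreasing and $\beta(\delta,s)\to0$ as $s\to\infty$ for each $\delta\ge0$, such that for every $x\in\mathbb R^n\setminus\mathcal T$ there are a measurable control $\alpha:[0,\infty)\to A$, a time $T\in(0,\infty]$ and a (Carathéodory) solution $y:[0,T)\to\mathbb R^n\setminus\mathcal T$ of the system with control $\alpha$ and $y(0)=x$,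 satisfying $\lim_{t\to T^-}\mathbf d(y(t))=0$ and $\mathbf d(y(t))\le\beta(\mathbf d(x),t)$ for all $t\ge0$, where, if $T<\infty$, $y$ is prolonged by a constant point of $\partial\mathcal T$ on $[T,\infty)$. -/

import Mathlib

open Set Filter Topology MeasureTheory

namespace DriftCLF

/-- The state space `ℝⁿ` with its Euclidean norm and inner product. -/
abbrev State (n : ℕ) : Type := EuclideanSpace ℝ (Fin n)

/-- The vector field `g` is of class `C¹_b` on the (open) set `Ω`: it is `C¹` there and both `g`
and its derivative are bounded on `Ω`. -/
def IsCOneBounded {n : ℕ} (Ω : Set (State n)) (g : State n → State n) : Prop :=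
  ContDiffOn ℝ 1 g Ω ∧ ∃ M : ℝ, ∀ x ∈ Ω, ‖g x‖ ≤ M ∧ ‖fderiv ℝ g x‖ ≤ M

/-- The control set `A = {0, ±e₁, …, ±e_m}`. -/
def controlSet (m : ℕ) : Set (Fin m → ℝ) :=
  {a | a = 0 ∨ ∃ i : Fin m, a = Pi.single i 1 ∨ a = -Pi.single i 1}

/-- The right-hand side `f₀(y) + ∑ aᵢ fᵢ(y)` of the control system. -/
def dynamics {n m : ℕ} (f₀ : State n → State n) (f : Fin m → State n → State n)
    (y : State n) (a : Fin m → ℝ) : State n :=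
  f₀ y + ∑ i, a i • f i y

/-- `y` is a (Carathéodory) solution in `ℝⁿ ∖ 𝒯`, on `[0, T)`, of the control system with
control `α` and initial state `x`. -/
def IsSolution {n m : ℕ} (f₀ : State n → State n) (f : Fin m → State n → State n)
    (𝒯 : Set (State n)) (x : State n) (α : ℝ → Fin m → ℝ) (T : EReal) (y : ℝ → State n) : Prop :=
  ContinuousOn y {t : ℝ | 0 ≤ t ∧ (t : EReal) < T} ∧
  ∀ t : ℝ, 0 ≤ t → (t : EReal) < T →
    y t ∉ 𝒯 ∧
    IntervalIntegrable (fun s => dynamics f₀ f (y s) (α s)) volume 0 t ∧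
    y t = x + ∫ s in (0 : ℝ)..t, dynamics f₀ f (y s) (α s)

/-- Admissible trajectory-control pair issuing from `x`, with (possibly infinite) final time `T`:
the control is measurable with values in `A`, `y` solves the system on `[0, T)`, and the distance
of `y t` from the target tends to `0` as `t → T⁻`. -/
def IsAdmissible {n m : ℕ} (f₀ : State n → State n) (f : Fin m → State n → State n)
    (𝒯 : Set (State n)) (x : State n) (T : EReal) (y : ℝ → State n) (α : ℝ → Fin m → ℝ) : Prop :=
  Measurable α ∧ (∀ t : ℝ, 0 ≤ t → α t ∈ controlSet m) ∧
  0 < T ∧ IsSolution f₀ f 𝒯 x α T y ∧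
  ∀ ε : ℝ, 0 < ε → ∃ s : ℝ, 0 ≤ s ∧ (s : EReal) < T ∧
    ∀ t : ℝ, s < t → (t : EReal) < T → Metric.infDist (y t) 𝒯 < ε

/-- Functions of class `𝒦ℒ` on `[0, ∞) × [0, ∞)`. -/
structure IsKL (β : ℝ → ℝ → ℝ) : Prop where
  continuousOn : ContinuousOn (fun q : ℝ × ℝ => β q.1 q.2) (Ici 0 ×ˢ Ici 0)
  nonneg : ∀ δ s, 0 ≤ δ → 0 ≤ s → 0 ≤ β δ s
  zero_left : ∀ s, 0 ≤ s → β 0 s = 0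
  strictMonoOn : ∀ s, 0 ≤ s → StrictMonoOn (fun δ => β δ s) (Ici 0)
  unbounded : ∀ s, 0 ≤ s → ¬ BddAbove ((fun δ => β δ s) '' Ici 0)
  antitoneOn : ∀ δ, 0 ≤ δ → AntitoneOn (β δ) (Ici 0)
  tendsto_zero : ∀ δ, 0 ≤ δ → Tendsto (β δ) atTop (𝓝 0)

/-- Global asymptotic controllability to the target `𝒯`. When the final time `T` is finite the
trajectory is prolonged to `[T, ∞)` by a constant point of `∂𝒯`. -/
def IsGAC {n m : ℕ} (f₀ : State n → State n) (f : Fin m → State n → State n)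
    (𝒯 : Set (State n)) : Prop :=
  ∃ β : ℝ → ℝ → ℝ, IsKL β ∧
    ∀ x : State n, x ∉ 𝒯 →
      ∃ (T : EReal) (y : ℝ → State n) (α : ℝ → Fin m → ℝ),
        IsAdmissible f₀ f 𝒯 x T y α ∧
        (∃ z ∈ frontier 𝒯, ∀ t : ℝ, T ≤ (t : EReal) → y t = z) ∧
        ∀ t : ℝ, 0 ≤ t → Metric.infDist (y t) 𝒯 ≤ β (Metric.infDist x 𝒯) t

/-- Semiconcavity on an arbitrary set. -/
def IsSemiconcaveOn {n : ℕ} (Ω : Set (State n)) (F : State n → ℝ) : Prop :=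
  ContinuousOn F Ω ∧ ∃ ρ : ℝ, 0 < ρ ∧ ∀ z₁ ∈ Ω, ∀ z₂ ∈ Ω, segment ℝ z₁ z₂ ⊆ Ω →
    F z₁ + F z₂ - 2 * F (midpoint ℝ z₁ z₂) ≤ ρ * ‖z₁ - z₂‖ ^ 2

/-- Local semiconcavity: semiconcavity on every compact subset. -/
def IsLocallySemiconcaveOn {n : ℕ} (Ω : Set (State n)) (F : State n → ℝ) : Prop :=
  ∀ K : Set (State n), IsCompact K → K ⊆ Ω → IsSemiconcaveOn K F

/-- The set `D*F(x)` of limiting gradients at `x` of a function `F` on the open set `Ω`. -/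
def limitingGradients {n : ℕ} (Ω : Set (State n)) (F : State n → ℝ) (x : State n) :
    Set (State n) :=
  {w | ∃ u : ℕ → State n, (∀ k, u k ∈ Ω ∧ u k ≠ x ∧ DifferentiableAt ℝ F (u k)) ∧
    Tendsto u atTop (𝓝 x) ∧ Tendsto (fun k => gradient F (u k)) atTop (𝓝 w)}

/-- The family `{f₀, f₀ - fᵢ, f₀ + fᵢ}`. -/
def familyOne {n m : ℕ} (f₀ : State n → State n) (f : Fin m → State n → State n) :
    Set (State n → State n) :=
  {g | g = f₀ ∨ ∃ i : Fin m, g = f₀ - f i ∨ g = f₀ + f i}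

/-- The family of degree at most two: `familyOne` together with the brackets `±[f₀, fᵢ]` and
`[fⱼ, f_ℓ]`, each multiplied by the characteristic function of `{f₀ = 0}`. Here
`VectorField.lieBracket ℝ X Y x = DY(x) X(x) - DX(x) Y(x)`. -/
def familyTwo {n m : ℕ} (f₀ : State n → State n) (f : Fin m → State n → State n) :
    Set (State n → State n) :=
  familyOne f₀ f ∪
    {g | (∃ i : Fin m,
            g = indicator {x | f₀ x = 0} (VectorField.lieBracket ℝ f₀ (f i)) ∨
            g = indicator {x | f₀ x = 0} (-VectorField.lieBracket ℝ f₀ (f i))) ∨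
         ∃ j l : Fin m, g = indicator {x | f₀ x = 0} (VectorField.lieBracket ℝ (f j) (f l))}

/-- The degree-2 Hamiltonian: the infimum (over a finite nonempty family) of `⟨p, g(x)⟩`. -/
noncomputable def hamiltonianTwo {n m : ℕ} (f₀ : State n → State n)
    (f : Fin m → State n → State n) (x p : State n) : ℝ :=
  sInf ((fun g : State n → State n => inner ℝ p (g x)) '' familyTwo f₀ f)

/-- Degree-2 control Lyapunov functions. Only the values of `U` on `closure (ℝⁿ ∖ 𝒯)` matter. -/
structure IsDegreeTwoCLF {n m : ℕ} (f₀ : State n → State n) (f : Fin m → State n → State n)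
    (𝒯 : Set (State n)) (U : State n → ℝ) : Prop where
  continuousOn : ContinuousOn U (closure 𝒯ᶜ)
  semiconcave : IsLocallySemiconcaveOn 𝒯ᶜ U
  pos : ∀ x, x ∉ 𝒯 → 0 < U x
  zero_frontier : ∀ x ∈ frontier 𝒯, U x = 0
  proper : ∀ K : Set ℝ, IsCompact K → K ⊆ Ici 0 → IsCompact {x | x ∈ closure 𝒯ᶜ ∧ U x ∈ K}
  decrease : ∀ x, x ∉ 𝒯 → ∀ p ∈ limitingGradients 𝒯ᶜ U x, hamiltonianTwo f₀ f x p < 0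

end DriftCLF

/-!
Semiconcavity of `U` provides, at every `x₀ ∉ 𝒯`, a limiting gradient `p` and a quadratic upper
bound `U z ≤ U x₀ + ⟪p, z - x₀⟫ + c ‖z - x₀‖²`. Following constant controls one after another,
each for a time `t` or a fixed multiple of it, leads from `x₀` to `x₀ + t v + t² w + o(t²)`. The
vectors `f₀` and `f₀ ± fᵢ` occur as `v`. Where `f₀` vanishes, words of controls `±eᵢ` with `v = 0`
produce as `w` the vectors `±Df₀ fᵢ`, which are the brackets `±[f₀, fᵢ]` up to sign, and `[fⱼ, f_ℓ]`
up to a combination of these. As `H⁽²⁾(x₀, p) < 0`, one of the endpoints has a smaller value of `U`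
than `x₀`.

By compactness the decrease of `U` achieved in at most unit time is bounded below on
`{a ≤ U ≤ b}`, for `0 < a`. Iterating such steps, one enters `{U ≤ a}` from `{U ≤ b}` after a
bounded time, never exceeding twice the initial value of `U`. As `U` and the distance from the
target are each small, or bounded, where the other is, the distances along these trajectories have
a `𝒦ℒ` majorant.
-/

namespace DriftCLF

/-! ### Local flows and their second-order expansion -/

section Flow

variable {E : Type*} [NormedAddCommGroup E] [NormedSpace ℝ E]

/-- The pairs `(t, s)` with `0 ≤ s ≤ t` as `t → 0⁺`: asymptotics along this filter are those of a
family of curves, the `t`-th of which is parametrized by `s ∈ [0, t]`, uniformly in `s`. -/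
def shortTimes : Filter (ℝ × ℝ) :=
  comap Prod.fst (𝓝[>] 0) ⊓ 𝓟 {p | p.2 ∈ Icc 0 p.1}

lemma eventually_shortTimes_iff {P : ℝ × ℝ → Prop} :
    (∀ᶠ p in shortTimes, P p) ↔ ∀ᶠ t in 𝓝[>] 0, ∀ s ∈ Icc 0 t, P (t, s) := by
  simp only [shortTimes, eventually_inf_principal, eventually_comap, Prod.forall]
  exact eventually_congr (Eventually.of_forall fun t =>
    ⟨fun h s hs => h t s rfl hs, by rintro h _ s rfl hs; exact h s hs⟩)

lemma tendsto_fst_shortTimes : Tendsto Prod.fst shortTimes (𝓝[>] 0) :=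
  tendsto_comap.mono_left inf_le_left

lemma tendsto_diag_shortTimes : Tendsto (fun t : ℝ => (t, t)) (𝓝[>] 0) shortTimes := by
  intro S hS
  change ∀ᶠ t in 𝓝[>] (0 : ℝ), (t, t) ∈ S
  filter_upwards [eventually_shortTimes_iff.1 hS, self_mem_nhdsWithin] with t ht (ht₀ : 0 < t)
  exact ht t (right_mem_Icc.2 ht₀.le)

lemma isLittleO_fst_shortTimes {k l : ℕ} (h : k < l) :
    (fun p : ℝ × ℝ => p.1 ^ l) =o[shortTimes] fun p => p.1 ^ k :=
  (Asymptotics.isLittleO_pow_pow h).comp_tendsto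
    (tendsto_fst_shortTimes.mono_right nhdsWithin_le_nhds)

section MeanValue

variable {g g' : ℝ × ℝ → E} {k : ℕ}

lemma isBigOWith_sub_of_hasDerivWithinAt {c : ℝ}
    (hg : ∀ᶠ t in 𝓝[>] 0, ∀ s ∈ Icc 0 t,
      HasDerivWithinAt (fun s => g (t, s)) (g' (t, s)) (Icc 0 t) s)
    (hg' : Asymptotics.IsBigOWith c shortTimes g' fun p => p.1 ^ k) :
    Asymptotics.IsBigOWith c shortTimes (fun p => g p - g (p.1, 0)) fun p => p.1 ^ (k + 1) := by
  rw [Asymptotics.isBigOWith_iff, eventually_shortTimes_iff] at hg' ⊢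
  filter_upwards [hg, hg', self_mem_nhdsWithin] with t hd hb (ht : 0 < t) s hs
  have hmv := (convex_Icc 0 t).norm_image_sub_le_of_norm_hasDerivWithin_le hd hb
    (left_mem_Icc.2 ht.le) hs
  have hc : 0 ≤ c * ‖t ^ k‖ := (norm_nonneg _).trans (hb s hs)
  calc ‖g (t, s) - g (t, 0)‖ ≤ c * ‖t ^ k‖ * ‖s - 0‖ := hmv
    _ ≤ c * ‖t ^ k‖ * ‖t‖ := by
      gcongr
      simpa [abs_of_nonneg hs.1, abs_of_pos ht] using hs.2
    _ = c * ‖t ^ (k + 1)‖ := by rw [pow_succ, norm_mul, mul_assoc]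

lemma isBigO_sub_of_hasDerivWithinAt
    (hg : ∀ᶠ t in 𝓝[>] 0, ∀ s ∈ Icc 0 t,
      HasDerivWithinAt (fun s => g (t, s)) (g' (t, s)) (Icc 0 t) s)
    (hg' : g' =O[shortTimes] fun p => p.1 ^ k) :
    (fun p => g p - g (p.1, 0)) =O[shortTimes] fun p => p.1 ^ (k + 1) :=
  let ⟨_, hc⟩ := hg'.isBigOWith
  (isBigOWith_sub_of_hasDerivWithinAt hg hc).isBigO

lemma isLittleO_sub_of_hasDerivWithinAt
    (hg : ∀ᶠ t in 𝓝[>] 0, ∀ s ∈ Icc 0 t,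
      HasDerivWithinAt (fun s => g (t, s)) (g' (t, s)) (Icc 0 t) s)
    (hg' : g' =o[shortTimes] fun p => p.1 ^ k) :
    (fun p => g p - g (p.1, 0)) =o[shortTimes] fun p => p.1 ^ (k + 1) :=
  .of_isBigOWith fun _ hc => isBigOWith_sub_of_hasDerivWithinAt hg (hg'.forall_isBigOWith hc)

end MeanValue

section Expansion

variable {X : E → E} {A : E →L[ℝ] E} {x₀ v w : E} {Y : ℝ × ℝ → E}

lemma isBigO_sub_of_isLittleO_sub_sub_sq {z : ℝ → E}
    (hz : (fun t => z t - x₀ - t • v - t ^ 2 • w) =o[𝓝[>] 0] fun t : ℝ => t ^ 2) :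
    (fun t => z t - x₀ - t • v) =O[𝓝[>] 0] fun t : ℝ => t ^ 2 := by
  have hw : (fun t : ℝ => t ^ 2 • w) =O[𝓝[>] 0] fun t : ℝ => t ^ 2 := by
    simpa using (Asymptotics.isBigO_refl (fun t : ℝ => t ^ 2) (𝓝[>] 0)).smul
      (Asymptotics.isBigO_const_const w (one_ne_zero (α := ℝ)) _)
  exact (hz.isBigO.add hw).congr_left fun t => by abel

lemma isLittleO_velocity_expansion (hX : HasFDerivAt X A x₀)
    (hY : ∀ᶠ t in 𝓝[>] 0, ∀ s ∈ Icc 0 t,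
      HasDerivWithinAt (fun s => Y (t, s)) (X (Y (t, s))) (Icc 0 t) s)
    (hlim : Tendsto Y shortTimes (𝓝 x₀))
    (hz : (fun p => Y (p.1, 0) - x₀ - p.1 • v) =O[shortTimes] fun p => p.1 ^ 2) :
    (fun p => X (Y p) - X x₀ - p.1 • A v - p.2 • A (X x₀)) =o[shortTimes] fun p => p.1 ^ 1 := by
  have hfst (u : E) : (fun p : ℝ × ℝ => p.1 • u) =O[shortTimes] fun p => p.1 ^ 1 := by
    simpa using (Asymptotics.isBigO_refl (fun p : ℝ × ℝ => p.1) shortTimes).smul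
      (Asymptotics.isBigO_const_const u (one_ne_zero (α := ℝ)) _)
  have hsq : (fun p : ℝ × ℝ => p.1 ^ 2) =o[shortTimes] fun p => p.1 ^ 1 :=
    isLittleO_fst_shortTimes one_lt_two
  have hXY : (fun p => X (Y p)) =O[shortTimes] fun p => p.1 ^ 0 := by
    simpa using (hX.continuousAt.tendsto.comp hlim).isBigO_one ℝ
  have hdist : (fun p => Y p - x₀) =O[shortTimes] fun p => p.1 ^ 1 :=
    (((isBigO_sub_of_hasDerivWithinAt hY hXY).add (hz.trans hsq.isBigO)).add
      (hfst v)).congr_left fun p => by abel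
  have hvel : (fun p => X (Y p) - X x₀) =O[shortTimes] fun p => p.1 ^ 1 :=
    (hX.isBigO_sub.comp_tendsto hlim).trans hdist
  have hmove : (fun p => Y p - p.2 • X x₀ - (Y (p.1, 0) - (0 : ℝ) • X x₀))
      =O[shortTimes] fun p => p.1 ^ 2 :=
    isBigO_sub_of_hasDerivWithinAt (g := fun p => Y p - p.2 • X x₀)
      (hY.mono fun t ht s hs => by
        simpa using (ht s hs).fun_sub ((hasDerivWithinAt_id s _).smul_const (X x₀))) hvel
  have hlin : (fun p => A (Y p - x₀ - p.1 • v - p.2 • X x₀)) =o[shortTimes] fun p => p.1 ^ 1 :=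
    ((A.isBigO_comp _ _).trans ((hmove.add hz).congr_left fun p => by module)).trans_isLittleO hsq
  have hrem : (fun p => X (Y p) - X x₀ - A (Y p - x₀)) =o[shortTimes] fun p => p.1 ^ 1 :=
    (hX.isLittleO.comp_tendsto hlim).trans_isBigO hdist
  exact (hrem.add hlin).congr_left fun p => by simp only [map_sub, map_smul]; abel

lemma isLittleO_flow_expansion (hX : HasFDerivAt X A x₀)
    (hY : ∀ᶠ t in 𝓝[>] 0, ∀ s ∈ Icc 0 t,
      HasDerivWithinAt (fun s => Y (t, s)) (X (Y (t, s))) (Icc 0 t) s)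
    (hlim : Tendsto Y shortTimes (𝓝 x₀))
    (hz : (fun t => Y (t, 0) - x₀ - t • v - t ^ 2 • w) =o[𝓝[>] 0] fun t : ℝ => t ^ 2) :
    (fun t => Y (t, t) - x₀ - t • (v + X x₀) - t ^ 2 • (w + A v + (1 / 2 : ℝ) • A (X x₀)))
      =o[𝓝[>] 0] fun t : ℝ => t ^ 2 := by
  have hvel := isLittleO_velocity_expansion hX hY hlim
    ((isBigO_sub_of_isLittleO_sub_sub_sq hz).comp_tendsto tendsto_fst_shortTimes)
  have hderiv : ∀ᶠ t in 𝓝[>] 0, ∀ s ∈ Icc 0 t, HasDerivWithinAt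
      (fun s => Y (t, s) - s • X x₀ - s • t • A v - (s ^ 2 / 2) • A (X x₀))
      (X (Y (t, s)) - X x₀ - t • A v - s • A (X x₀)) (Icc 0 t) s := by
    filter_upwards [hY] with t ht s hs
    have hsq : HasDerivWithinAt (fun s : ℝ => s ^ 2 / 2) s (Icc 0 t) s := by
      simpa using ((hasDerivAt_pow 2 s).div_const 2).hasDerivWithinAt (s := Icc 0 t)
    simpa using (((ht s hs).fun_sub ((hasDerivWithinAt_id s _).smul_const (X x₀))).fun_sub
      ((hasDerivWithinAt_id s _).smul_const (t • A v))).fun_sub (hsq.smul_const (A (X x₀)))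
  have hmove := (isLittleO_sub_of_hasDerivWithinAt
    (g := fun p => Y p - p.2 • X x₀ - p.2 • p.1 • A v - (p.2 ^ 2 / 2) • A (X x₀))
    hderiv hvel).comp_tendsto tendsto_diag_shortTimes
  exact (hmove.add hz).congr_left fun t => by
    simp only [Function.comp_apply]
    module

end Expansion

/-- The germ at `x₀` of the forward flow of the vector field `X`: all properties are required of
initial points close to `x₀` and of small positive times only. -/
structure IsLocalFlow (X : E → E) (x₀ : E) (φ : E → ℝ → E) : Prop where
  apply_zero : ∀ᶠ x in 𝓝 x₀, φ x 0 = x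
  hasDerivWithinAt : ∀ᶠ p in 𝓝 x₀ ×ˢ 𝓝[>] (0 : ℝ), ∀ s ∈ Icc 0 p.2,
    HasDerivWithinAt (φ p.1) (X (φ p.1 s)) (Icc 0 p.2) s
  eventually_mem : ∀ V ∈ 𝓝 x₀, ∀ᶠ p in 𝓝 x₀ ×ˢ 𝓝[>] (0 : ℝ), ∀ s ∈ Icc 0 p.2, φ p.1 s ∈ V
  continuousAt : ∀ᶠ p in 𝓝 x₀ ×ˢ 𝓝[>] (0 : ℝ), ContinuousAt (φ · p.2) p.1

lemma exists_isLocalFlow [CompleteSpace E] {X : E → E} {x₀ : E} (hX : ContDiffAt ℝ 1 X x₀) :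
    ∃ φ, IsLocalFlow X x₀ φ := by
  obtain ⟨ε, hε, _, r, _, _, hr, hPL⟩ := IsPicardLindelof.of_contDiffAt_one hX
  obtain ⟨φ, hφ, hcont⟩ :=
    (hPL 0).exists_forall_mem_closedBall_eq_hasDerivWithinAt_continuousOn
  simp only [zero_sub, zero_add] at hφ hcont
  have hr : (0 : ℝ) < r := hr
  have hball : ∀ᶠ x in 𝓝 x₀, x ∈ Metric.ball x₀ r := Metric.ball_mem_nhds _ hr
  have hdom : ∀ᶠ p in 𝓝 x₀ ×ˢ 𝓝[>] (0 : ℝ), p.1 ∈ Metric.ball x₀ r ∧ p.2 ∈ Ioo 0 ε :=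
    hball.prod_mk (Ioo_mem_nhdsGT hε)
  have hcontAt (x : E) (hx : x ∈ Metric.ball x₀ r) (t : ℝ) (ht : t ∈ Ioo (-ε) ε) :
      ContinuousAt φ (x, t) :=
    hcont.continuousAt (prod_mem_nhds (Metric.closedBall_mem_nhds_of_mem hx)
      (Icc_mem_nhds ht.1 ht.2))
  refine ⟨fun x t => φ (x, t), ?_, ?_, fun V hV => ?_, ?_⟩
  · filter_upwards [hball] with x hx
    exact (hφ x (Metric.ball_subset_closedBall hx)).1
  · filter_upwards [hdom] with p ⟨hx, ht⟩ s hs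
    have hsub : Icc 0 p.2 ⊆ Icc (-ε) ε := Icc_subset_Icc (by linarith) ht.2.le
    exact ((hφ p.1 (Metric.ball_subset_closedBall hx)).2 s (hsub hs)).mono hsub
  · have hφ₀ : φ (x₀, 0) = x₀ := (hφ x₀ (Metric.mem_closedBall_self hr.le)).1
    have hnear : ∀ᶠ q in 𝓝 x₀ ×ˢ 𝓝 (0 : ℝ), φ q ∈ V := by
      rw [← nhds_prod_eq]
      exact (hcontAt x₀ (Metric.mem_ball_self hr) 0 (by simpa)).eventually_mem (by rwa [hφ₀])
    obtain ⟨P, hP, Q, hQ, hPQ⟩ := eventually_prod_iff.1 hnear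
    obtain ⟨δ, hδ, hδQ⟩ := Metric.eventually_nhds_iff.1 hQ
    filter_upwards [hP.prod_mk (Ioo_mem_nhdsGT hδ)] with p ⟨hx, ht⟩ s hs
    exact hPQ hx (hδQ (by simpa [abs_of_nonneg hs.1] using hs.2.trans_lt ht.2))
  · filter_upwards [hdom] with p ⟨hx, ht⟩
    exact (hcontAt p.1 hx p.2 ⟨by linarith [ht.1], ht.2⟩).comp
      (f := fun x => (x, p.2)) (by fun_prop)

end Flow

/-! ### Pieces of trajectories of a control system -/

section Arc

variable {E C : Type*} [NormedAddCommGroup E] [NormedSpace ℝ E] {F : E → C → E}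
  {V V' : Set E} {a b c : ℝ} {α α' : ℝ → C} {y y' : ℝ → E}

/-- `y` is on `[a, b]` a Carathéodory solution of `ẏ = F(y, α)` with values in `V`. -/
def IsArc (F : E → C → E) (V : Set E) (a b : ℝ) (α : ℝ → C) (y : ℝ → E) : Prop :=
  ContinuousOn y (Icc a b) ∧ ∀ t ∈ Icc a b, y t ∈ V ∧
    IntervalIntegrable (fun s => F (y s) (α s)) volume a t ∧
    y t = y a + ∫ s in a..t, F (y s) (α s)

lemma IsArc.mono (h : IsArc F V a b α y) (hV : V ⊆ V') : IsArc F V' a b α y :=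
  ⟨h.1, fun t ht => ⟨hV (h.2 t ht).1, (h.2 t ht).2⟩⟩

lemma IsArc.mono_right (h : IsArc F V a b α y) (hcb : c ≤ b) : IsArc F V a c α y :=
  ⟨h.1.mono (Icc_subset_Icc_right hcb), fun t ht => h.2 t ⟨ht.1, ht.2.trans hcb⟩⟩

lemma IsArc.concat (hab : a ≤ b) (hbc : b ≤ c) (h₁ : IsArc F V a b α y)
    (h₂ : IsArc F V b c α y) : IsArc F V a c α y := by
  refine ⟨?_, fun t ht => ?_⟩
  · rw [← Icc_union_Icc_eq_Icc hab hbc]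
    exact h₁.1.union_of_isClosed h₂.1 isClosed_Icc isClosed_Icc
  · rcases le_total t b with htb | hbt
    · exact h₁.2 t ⟨ht.1, htb⟩
    · obtain ⟨-, hint₁, hy₁⟩ := h₁.2 b ⟨hab, le_rfl⟩
      obtain ⟨hV, hint₂, hy₂⟩ := h₂.2 t ⟨hbt, ht.2⟩
      refine ⟨hV, hint₁.trans hint₂, ?_⟩
      rw [hy₂, ← intervalIntegral.integral_add_adjacent_intervals hint₁ hint₂, ← add_assoc, ← hy₁]

lemma IsArc.of_forall_consecutive {s : ℕ → ℝ} (hs : Monotone s)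
    (h : ∀ k, IsArc F V (s k) (s (k + 1)) α y) (k : ℕ) : IsArc F V (s 0) (s k) α y := by
  induction k with
  | zero => exact (h 0).mono_right (hs zero_le_one)
  | succ k ih => exact ih.concat (hs k.zero_le) (hs k.le_succ) (h k)

lemma IsArc.congr (h : IsArc F V a b α y) (hy : EqOn y' y (Icc a b))
    (hα : EqOn α' α (Ioo a b)) : IsArc F V a b α' y' := by
  refine ⟨h.1.congr hy, fun t ht => ?_⟩
  obtain ⟨hV, hint, hyt⟩ := h.2 t ht
  have hF : EqOn (fun s => F (y s) (α s)) (fun s => F (y' s) (α' s)) (Ioo a t) := by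
    intro s hs
    have hs' : s ∈ Ioo a b := ⟨hs.1, hs.2.trans_le ht.2⟩
    simp only [hy (Ioo_subset_Icc_self hs'), hα hs']
  refine ⟨by rwa [hy ht], ?_, ?_⟩
  · rw [intervalIntegrable_iff_integrableOn_Ioo_of_le ht.1] at hint ⊢
    exact hint.congr_fun hF measurableSet_Ioo
  · rw [hy ht, hy (left_mem_Icc.2 (ht.1.trans ht.2)), hyt, intervalIntegral.integral_of_le ht.1,
      intervalIntegral.integral_of_le ht.1, integral_Ioc_eq_integral_Ioo,
      integral_Ioc_eq_integral_Ioo, setIntegral_congr_fun measurableSet_Ioo hF]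

lemma IsArc.shift (h : IsArc F V 0 b α y) (a : ℝ) :
    IsArc F V a (a + b) (fun t => α (t - a)) fun t => y (t - a) := by
  have hmem : ∀ t ∈ Icc a (a + b), t - a ∈ Icc 0 b := fun t ht =>
    ⟨by linarith [ht.1], by linarith [ht.2]⟩
  refine ⟨h.1.comp (by fun_prop) hmem, fun t ht => ?_⟩
  obtain ⟨hV, hint, hyt⟩ := h.2 _ (hmem t ht)
  refine ⟨hV, by simpa using hint.comp_sub_right a, ?_⟩
  rw [intervalIntegral.integral_comp_sub_right (fun s => F (y s) (α s)) a, sub_self]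
  simpa using hyt

lemma IsArc.of_integralCurve [CompleteSpace E] {u : C}
    (hF : ∀ z ∈ V, ContinuousAt (fun z => F z u) z)
    (hy : ∀ t ∈ Icc 0 b, HasDerivWithinAt y (F (y t) u) (Icc 0 b) t)
    (hV : ∀ t ∈ Icc 0 b, y t ∈ V) : IsArc F V 0 b (fun _ => u) y := by
  have hyc : ContinuousOn y (Icc 0 b) := fun t ht => (hy t ht).continuousWithinAt
  have hFy : ContinuousOn (fun s => F (y s) u) (Icc 0 b) := fun s hs =>
    (hF _ (hV s hs)).comp_continuousWithinAt (f := y) (hyc s hs)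
  refine ⟨hyc, fun t ht => ?_⟩
  have hsub : Icc 0 t ⊆ Icc 0 b := Icc_subset_Icc_right ht.2
  have hint := (hFy.mono hsub).intervalIntegrable_of_Icc (μ := volume) ht.1
  refine ⟨hV t ht, hint, ?_⟩
  rw [intervalIntegral.integral_eq_sub_of_hasDerivAt_of_le ht.1 (hyc.mono hsub)
    (fun s hs => (hy s ⟨hs.1.le, hs.2.le.trans ht.2⟩).hasDerivAt
      (Icc_mem_nhds hs.1 (hs.2.trans_le ht.2))) hint, add_sub_cancel]

variable [MeasurableSpace C] {A : Set C} {τ τ₁ τ₂ : ℝ} {x x' x'' : E}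

/-- `x'` is reached from `x` in time `τ` by a trajectory of `ẏ = F(y, α)` that stays in `V`, where
the control `α` is measurable with values in `A`. -/
def Reach (F : E → C → E) (A : Set C) (V : Set E) (τ : ℝ) (x x' : E) : Prop :=
  0 ≤ τ ∧ ∃ (α : ℝ → C) (y : ℝ → E), Measurable α ∧ (∀ t, α t ∈ A) ∧
    IsArc F V 0 τ α y ∧ y 0 = x ∧ y τ = x'

lemma Reach.mono (h : Reach F A V τ x x') (hV : V ⊆ V') : Reach F A V' τ x x' := by
  obtain ⟨hτ, α, y, hα, hA, hy, hends⟩ := h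
  exact ⟨hτ, α, y, hα, hA, hy.mono hV, hends⟩

lemma Reach.mem (h : Reach F A V τ x x') : x' ∈ V := by
  obtain ⟨hτ, _, _, _, _, hy, -, rfl⟩ := h
  exact (hy.2 τ (right_mem_Icc.2 hτ)).1

lemma Reach.pos_of_ne (h : Reach F A V τ x x') (hne : x ≠ x') : 0 < τ := by
  obtain ⟨hτ, _, _, _, _, _, rfl, rfl⟩ := h
  exact hτ.lt_of_ne fun h => hne (by rw [h])

lemma Reach.refl (hA : A.Nonempty) (hx : x ∈ V) : Reach F A V 0 x x := by
  obtain ⟨u, hu⟩ := hA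
  refine ⟨le_rfl, fun _ => u, fun _ => x, measurable_const, fun _ => hu,
    ⟨continuousOn_const, fun t ht => ?_⟩, rfl, rfl⟩
  obtain rfl : t = 0 := by simpa using ht
  simpa using hx

lemma Reach.trans (h₁ : Reach F A V τ₁ x x') (h₂ : Reach F A V τ₂ x' x'') :
    Reach F A V (τ₁ + τ₂) x x'' := by
  obtain ⟨hτ₁, α₁, y₁, hα₁, hA₁, hy₁, rfl, rfl⟩ := h₁
  obtain ⟨hτ₂, α₂, y₂, hα₂, hA₂, hy₂, hmid, rfl⟩ := h₂
  refine ⟨by positivity, fun t => if t ≤ τ₁ then α₁ t else α₂ (t - τ₁),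
    fun t => if t ≤ τ₁ then y₁ t else y₂ (t - τ₁), ?_, fun t => ?_, ?_, by simp [hτ₁], ?_⟩
  · exact Measurable.ite measurableSet_Iic hα₁ (hα₂.comp (measurable_id.sub_const τ₁))
  · dsimp only
    split_ifs
    exacts [hA₁ _, hA₂ _]
  · refine (hy₁.congr (fun t ht => if_pos ht.2) (fun t ht => if_pos ht.2.le)).concat hτ₁
      (by linarith) ((hy₂.shift τ₁).congr (fun t ht => ?_) (fun t ht => if_neg (not_le.2 ht.1)))
    rcases ht.1.eq_or_lt with rfl | hlt
    · simp [hmid]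
    · exact if_neg (not_le.2 hlt)
  · rcases hτ₂.eq_or_lt with rfl | hlt
    · simp [hmid]
    · simp [hlt]

end Arc

/-! ### Steering by words of constant controls -/

section Steering

variable {E C : Type*} [NormedAddCommGroup E] [NormedSpace ℝ E] [MeasurableSpace C]
  {F : E → C → E} {A : Set C} {x₀ v w : E} {Φ : E → ℝ → E}

/-- `Φ x t` is, for `x` close to `x₀` and small `t > 0`, the end point of a trajectory issuing from
`x` that takes little time and stays close to `x₀`; it depends continuously on `x` at `x₀`. The
parameter `t` is not the duration of the trajectory, only a bound for it up to a factor. -/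
structure IsSteering (F : E → C → E) (A : Set C) (x₀ : E) (Φ : E → ℝ → E) : Prop where
  continuousAt : ∀ᶠ t in 𝓝[>] (0 : ℝ), ContinuousAt (Φ · t) x₀
  exists_reach : ∀ V ∈ 𝓝 x₀, ∀ ε > 0, ∀ᶠ p in 𝓝 x₀ ×ˢ 𝓝[>] (0 : ℝ),
    ∃ τ ≤ ε, Reach F A V τ p.1 (Φ p.1 p.2)

lemma tendsto_const_prodMk_nhdsGT_zero {S : Type*} [TopologicalSpace S] (x : S) :
    Tendsto (fun t : ℝ => (x, t)) (𝓝[>] 0) (𝓝 x ×ˢ 𝓝[>] 0) :=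
  tendsto_const_nhds.prodMk tendsto_id

lemma IsSteering.tendsto_prodMk (h : IsSteering F A x₀ Φ) :
    Tendsto (fun p : E × ℝ => (Φ p.1 p.2, p.2)) (𝓝 x₀ ×ˢ 𝓝[>] 0) (𝓝 x₀ ×ˢ 𝓝[>] 0) := by
  refine Tendsto.prodMk (fun V hV => ?_) tendsto_snd
  exact (h.exists_reach V hV 1 one_pos).mono fun p ⟨_, _, hp⟩ => hp.mem

lemma IsSteering.tendsto (h : IsSteering F A x₀ Φ) : Tendsto (Φ x₀) (𝓝[>] 0) (𝓝 x₀) :=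
  tendsto_fst.comp (h.tendsto_prodMk.comp (tendsto_const_prodMk_nhdsGT_zero x₀))

lemma IsSteering.id (hA : A.Nonempty) : IsSteering F A x₀ fun x _ => x where
  continuousAt := .of_forall fun _ => continuousAt_id
  exists_reach V hV ε hε := by
    filter_upwards [tendsto_fst.eventually_mem hV] with p hp
    exact ⟨0, hε.le, .refl hA hp⟩

lemma IsSteering.comp_isLocalFlow [CompleteSpace E] (h : IsSteering F A x₀ Φ) {u : C} (hu : u ∈ A)
    (hF : ∀ᶠ z in 𝓝 x₀, ContinuousAt (F · u) z) {φ : E → ℝ → E}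
    (hφ : IsLocalFlow (F · u) x₀ φ) : IsSteering F A x₀ fun x t => φ (Φ x t) t where
  continuousAt := by
    filter_upwards [h.continuousAt, (h.tendsto_prodMk.comp
      (tendsto_const_prodMk_nhdsGT_zero x₀)).eventually hφ.continuousAt] with t hΦ hφt
    exact ContinuousAt.comp (g := (φ · t)) hφt hΦ
  exists_reach V hV ε hε := by
    have hsmall : ∀ᶠ p in 𝓝 x₀ ×ˢ 𝓝[>] (0 : ℝ), p.2 ∈ Ioc 0 (ε / 2) :=
      tendsto_snd.eventually_mem (Ioc_mem_nhdsGT (half_pos hε))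
    filter_upwards [h.exists_reach V hV (ε / 2) (half_pos hε), hsmall,
      (tendsto_fst.comp h.tendsto_prodMk).eventually hφ.apply_zero,
      h.tendsto_prodMk.eventually hφ.hasDerivWithinAt,
      h.tendsto_prodMk.eventually (hφ.eventually_mem _ (inter_mem hV hF))]
      with p ⟨τ, hτ, hreach⟩ ⟨hp₀, hp⟩ hinit hderiv hmem
    have harc := (IsArc.of_integralCurve (fun z hz => hz.2) hderiv hmem).mono inter_subset_left
    exact ⟨τ + p.2, by linarith, hreach.trans
      ⟨hp₀.le, _, _, measurable_const, fun _ => hu, harc, hinit, rfl⟩⟩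

/-- The point `x₀` can be steered to `x₀ + t v + t² w + o(t²)` as `t → 0⁺`. -/
def Steers (F : E → C → E) (A : Set C) (x₀ v w : E) : Prop :=
  ∃ Φ, IsSteering F A x₀ Φ ∧
    (fun t => Φ x₀ t - x₀ - t • v - t ^ 2 • w) =o[𝓝[>] 0] fun t : ℝ => t ^ 2

lemma Steers.zero (hA : A.Nonempty) : Steers F A x₀ 0 0 :=
  ⟨_, .id hA, by simp⟩

lemma Steers.append [CompleteSpace E] (h : Steers F A x₀ v w) {u : C} (hu : u ∈ A) {X : E → E}
    (hFX : ∀ z, F z u = X z) (hX : ContDiffAt ℝ 1 X x₀) :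
    Steers F A x₀ (v + X x₀) (w + fderiv ℝ X x₀ v + (1 / 2 : ℝ) • fderiv ℝ X x₀ (X x₀)) := by
  obtain rfl : (F · u) = X := funext hFX
  obtain ⟨Φ, hΦ, hexp⟩ := h
  obtain ⟨φ, hφ⟩ := exists_isLocalFlow hX
  have hcurve := hΦ.tendsto_prodMk.comp (tendsto_const_prodMk_nhdsGT_zero x₀)
  have hstart : ∀ᶠ t in 𝓝[>] (0 : ℝ), φ (Φ x₀ t) 0 = Φ x₀ t :=
    hΦ.tendsto.eventually hφ.apply_zero
  have hlim : Tendsto (fun p : ℝ × ℝ => φ (Φ x₀ p.1) p.2) shortTimes (𝓝 x₀) := fun V hV =>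
    eventually_shortTimes_iff.2 (hcurve.eventually (hφ.eventually_mem V hV))
  exact ⟨_, hΦ.comp_isLocalFlow hu
    ((hX.eventually (by simp)).mono fun z hz => hz.continuousAt) hφ,
    isLittleO_flow_expansion (Y := fun p => φ (Φ x₀ p.1) p.2)
      (hX.differentiableAt one_ne_zero).hasFDerivAt
      (hcurve.eventually hφ.hasDerivWithinAt) hlim
      (hexp.congr' (hstart.mono fun t ht => by simp only [ht]) .rfl)⟩

end Steering

section Descent

variable {E C : Type*} [NormedAddCommGroup E] [InnerProductSpace ℝ E] [MeasurableSpace C]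
  {F : E → C → E} {A : Set C} {x₀ p v w : E}

/-- Some steering decreases at `x₀` every function that is bounded above near `x₀` by a quadratic
polynomial with value zero and gradient `p` at `x₀`. -/
def CanDescend (F : E → C → E) (A : Set C) (x₀ p : E) : Prop :=
  ∃ Φ, IsSteering F A x₀ Φ ∧ ∀ c : ℝ, ∀ᶠ t in 𝓝[>] (0 : ℝ),
    inner ℝ p (Φ x₀ t - x₀) + c * ‖Φ x₀ t - x₀‖ ^ 2 < 0

lemma eventually_inner_add_mul_sq_neg {ι : Type*} {l : Filter ι} {h : ι → E} {σ : ι → ℝ} {u : E}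
    (hσ : Tendsto σ l (𝓝[>] 0)) (hh : (fun i => h i - σ i • u) =o[l] σ)
    (hu : inner ℝ p u < 0) (c : ℝ) : ∀ᶠ i in l, inner ℝ p (h i) + c * ‖h i‖ ^ 2 < 0 := by
  have hσ₀ : ∀ᶠ i in l, 0 < σ i := hσ.eventually self_mem_nhdsWithin
  have hlim : Tendsto (fun i => (σ i)⁻¹ • h i) l (𝓝 u) := by
    have hdiff := (hh.tendsto_inv_smul_nhds_zero).add_const u
    rw [zero_add] at hdiff
    refine hdiff.congr' (hσ₀.mono fun i hi => ?_)
    rw [smul_sub, inv_smul_smul₀ hi.ne', sub_add_cancel]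
  have hquot : Tendsto (fun i => inner ℝ p ((σ i)⁻¹ • h i) + c * (σ i * ‖(σ i)⁻¹ • h i‖ ^ 2)) l
      (𝓝 (inner ℝ p u + c * (0 * ‖u‖ ^ 2))) :=
    (tendsto_const_nhds.inner hlim).add
      (((hσ.mono_right nhdsWithin_le_nhds).mul (hlim.norm.pow 2)).const_mul c)
  simp only [zero_mul, mul_zero, add_zero] at hquot
  filter_upwards [hquot.eventually_lt_const hu, hσ₀] with i hi hi₀
  calc inner ℝ p (h i) + c * ‖h i‖ ^ 2
      = σ i * (inner ℝ p ((σ i)⁻¹ • h i) + c * (σ i * ‖(σ i)⁻¹ • h i‖ ^ 2)) := by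
        rw [inner_smul_right, norm_smul, norm_inv, Real.norm_of_nonneg hi₀.le]
        field_simp
    _ < 0 := mul_neg_of_pos_of_neg hi₀ hi

lemma Steers.canDescend_of_inner_left_neg (h : Steers F A x₀ v w) (hv : inner ℝ p v < 0) :
    CanDescend F A x₀ p := by
  obtain ⟨Φ, hΦ, hexp⟩ := h
  have hsq : (fun t : ℝ => t ^ 2) =o[𝓝[>] 0] fun t => t := by
    simpa using (Asymptotics.isLittleO_pow_pow one_lt_two).mono nhdsWithin_le_nhds
  exact ⟨Φ, hΦ, eventually_inner_add_mul_sq_neg tendsto_id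
    ((isBigO_sub_of_isLittleO_sub_sub_sq hexp).trans_isLittleO hsq) hv⟩

lemma Steers.canDescend_of_inner_right_neg (h : Steers F A x₀ 0 w) (hw : inner ℝ p w < 0) :
    CanDescend F A x₀ p := by
  obtain ⟨Φ, hΦ, hexp⟩ := h
  have hsq : Tendsto (fun t : ℝ => t ^ 2) (𝓝[>] 0) (𝓝[>] 0) := by
    refine tendsto_nhdsWithin_iff.2 ⟨?_, ?_⟩
    · exact ((continuous_pow 2).tendsto' 0 0 (by simp)).mono_left nhdsWithin_le_nhds
    · filter_upwards [self_mem_nhdsWithin] with t (ht : 0 < t) using pow_pos ht 2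
  exact ⟨Φ, hΦ, eventually_inner_add_mul_sq_neg hsq (by simpa using hexp) hw⟩

end Descent

section Family

variable {n m : ℕ} {f₀ : State n → State n} {f : Fin m → State n → State n} {x₀ p v w : State n}
  {i j l : Fin m}

lemma dynamics_zero (z : State n) : dynamics f₀ f z 0 = f₀ z := by simp [dynamics]

lemma dynamics_single (z : State n) (i : Fin m) :
    dynamics f₀ f z (Pi.single i 1) = f₀ z + f i z := by
  simp [dynamics, Pi.single_apply, ite_smul]

lemma dynamics_neg_single (z : State n) (i : Fin m) :
    dynamics f₀ f z (-Pi.single i 1) = f₀ z - f i z := by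
  simp [dynamics, Pi.single_apply, ite_smul, sub_eq_add_neg]

lemma controlSet_nonempty : (controlSet m).Nonempty := ⟨0, Or.inl rfl⟩

lemma Steers.append_drift (h : Steers (dynamics f₀ f) (controlSet m) x₀ v w)
    (h₀ : ContDiffAt ℝ 1 f₀ x₀) :
    Steers (dynamics f₀ f) (controlSet m) x₀ (v + f₀ x₀)
      (w + fderiv ℝ f₀ x₀ v + (1 / 2 : ℝ) • fderiv ℝ f₀ x₀ (f₀ x₀)) :=
  h.append (Or.inl rfl) dynamics_zero h₀

lemma Steers.append_add (h : Steers (dynamics f₀ f) (controlSet m) x₀ v w)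
    (h₀ : ContDiffAt ℝ 1 f₀ x₀) (hi : ContDiffAt ℝ 1 (f i) x₀) :
    Steers (dynamics f₀ f) (controlSet m) x₀ (v + (f₀ x₀ + f i x₀))
      (w + (fderiv ℝ f₀ x₀ v + fderiv ℝ (f i) x₀ v) + (1 / 2 : ℝ) •
        (fderiv ℝ f₀ x₀ (f₀ x₀ + f i x₀) + fderiv ℝ (f i) x₀ (f₀ x₀ + f i x₀))) := by
  have := h.append (Or.inr ⟨i, Or.inl rfl⟩) (dynamics_single · i) (h₀.add hi)
  rwa [fderiv_fun_add (h₀.differentiableAt one_ne_zero) (hi.differentiableAt one_ne_zero)] at this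

lemma Steers.append_sub (h : Steers (dynamics f₀ f) (controlSet m) x₀ v w)
    (h₀ : ContDiffAt ℝ 1 f₀ x₀) (hi : ContDiffAt ℝ 1 (f i) x₀) :
    Steers (dynamics f₀ f) (controlSet m) x₀ (v + (f₀ x₀ - f i x₀))
      (w + (fderiv ℝ f₀ x₀ v - fderiv ℝ (f i) x₀ v) + (1 / 2 : ℝ) •
        (fderiv ℝ f₀ x₀ (f₀ x₀ - f i x₀) - fderiv ℝ (f i) x₀ (f₀ x₀ - f i x₀))) := by
  have := h.append (Or.inr ⟨i, Or.inr rfl⟩) (dynamics_neg_single · i) (h₀.sub hi)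
  rwa [fderiv_fun_sub (h₀.differentiableAt one_ne_zero) (hi.differentiableAt one_ne_zero)] at this

lemma steers_fderiv_drift (h₀ : ContDiffAt ℝ 1 f₀ x₀) (hz : f₀ x₀ = 0)
    (hi : ContDiffAt ℝ 1 (f i) x₀) :
    Steers (dynamics f₀ f) (controlSet m) x₀ 0 (fderiv ℝ f₀ x₀ (f i x₀)) := by
  -- the word `eᵢ, -eᵢ`
  convert ((Steers.zero controlSet_nonempty).append_add h₀ hi).append_sub h₀ hi using 1
  · rw [hz]; abel
  · simp only [hz, map_add, map_sub, map_zero]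
    module

lemma steers_neg_fderiv_drift (h₀ : ContDiffAt ℝ 1 f₀ x₀) (hz : f₀ x₀ = 0)
    (hi : ContDiffAt ℝ 1 (f i) x₀) :
    Steers (dynamics f₀ f) (controlSet m) x₀ 0 (-fderiv ℝ f₀ x₀ (f i x₀)) := by
  -- the word `-eᵢ, eᵢ`
  convert ((Steers.zero controlSet_nonempty).append_sub h₀ hi).append_add h₀ hi using 1
  · rw [hz]; abel
  · simp only [hz, map_add, map_sub, map_zero]
    module

lemma steers_lieBracket_add_drift (h₀ : ContDiffAt ℝ 1 f₀ x₀) (hz : f₀ x₀ = 0)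
    (hj : ContDiffAt ℝ 1 (f j) x₀) (hl : ContDiffAt ℝ 1 (f l) x₀) :
    Steers (dynamics f₀ f) (controlSet m) x₀ 0 (VectorField.lieBracket ℝ (f j) (f l) x₀
      + (2 : ℝ) • (fderiv ℝ f₀ x₀ (f j x₀) + fderiv ℝ f₀ x₀ (f l x₀))) := by
  -- the commutator word `eⱼ, e_ℓ, -eⱼ, -e_ℓ`
  convert ((((Steers.zero controlSet_nonempty).append_add h₀ hj).append_add h₀ hl).append_sub
    h₀ hj).append_sub h₀ hl using 1
  · rw [hz]; abel
  · simp only [hz, map_add, map_sub, map_zero, VectorField.lieBracket]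
    module

lemma canDescend_of_mem_familyOne (h₀ : ContDiffAt ℝ 1 f₀ x₀)
    (hf : ∀ i, ContDiffAt ℝ 1 (f i) x₀) {g : State n → State n} (hg : g ∈ familyOne f₀ f)
    (hneg : inner ℝ p (g x₀) < 0) : CanDescend (dynamics f₀ f) (controlSet m) x₀ p := by
  have hstart : Steers (dynamics f₀ f) (controlSet m) x₀ 0 0 := .zero controlSet_nonempty
  obtain rfl | ⟨i, rfl | rfl⟩ := hg
  · exact (hstart.append_drift h₀).canDescend_of_inner_left_neg (by simpa using hneg)
  · exact (hstart.append_sub h₀ (hf i)).canDescend_of_inner_left_neg (by simpa using hneg)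
  · exact (hstart.append_add h₀ (hf i)).canDescend_of_inner_left_neg (by simpa using hneg)

lemma canDescend_of_inner_fderiv_drift_ne_zero (h₀ : ContDiffAt ℝ 1 f₀ x₀) (hz : f₀ x₀ = 0)
    (hi : ContDiffAt ℝ 1 (f i) x₀) (hne : inner ℝ p (fderiv ℝ f₀ x₀ (f i x₀)) ≠ 0) :
    CanDescend (dynamics f₀ f) (controlSet m) x₀ p := by
  rcases hne.lt_or_gt with hlt | hgt
  · exact (steers_fderiv_drift h₀ hz hi).canDescend_of_inner_right_neg hlt
  · exact (steers_neg_fderiv_drift h₀ hz hi).canDescend_of_inner_right_neg (by simpa using hgt)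

-- The drift contribution to the commutator word is harmless: if `p` sees it, then `p` sees the
-- derivative of the drift along `fⱼ` or `f_ℓ`, and two-letter words already give descent.
lemma canDescend_of_inner_lieBracket_neg (h₀ : ContDiffAt ℝ 1 f₀ x₀) (hz : f₀ x₀ = 0)
    (hj : ContDiffAt ℝ 1 (f j) x₀) (hl : ContDiffAt ℝ 1 (f l) x₀)
    (hneg : inner ℝ p (VectorField.lieBracket ℝ (f j) (f l) x₀) < 0) :
    CanDescend (dynamics f₀ f) (controlSet m) x₀ p := by
  by_cases hDj : inner ℝ p (fderiv ℝ f₀ x₀ (f j x₀)) = 0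
  · by_cases hDl : inner ℝ p (fderiv ℝ f₀ x₀ (f l x₀)) = 0
    · refine (steers_lieBracket_add_drift h₀ hz hj hl).canDescend_of_inner_right_neg ?_
      simpa only [inner_add_right, inner_smul_right, hDj, hDl, add_zero, mul_zero] using hneg
    · exact canDescend_of_inner_fderiv_drift_ne_zero h₀ hz hl hDl
  · exact canDescend_of_inner_fderiv_drift_ne_zero h₀ hz hj hDj

lemma eq_zero_and_inner_neg_of_indicator {Y : State n → State n}
    (h : inner ℝ p (indicator {x | f₀ x = 0} Y x₀) < 0) : f₀ x₀ = 0 ∧ inner ℝ p (Y x₀) < 0 := by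
  have hmem : x₀ ∈ {x | f₀ x = 0} := by
    by_contra hx
    simp [indicator_of_notMem hx] at h
  exact ⟨hmem, by rwa [indicator_of_mem hmem] at h⟩

theorem canDescend_of_hamiltonianTwo_neg (h₀ : ContDiffAt ℝ 1 f₀ x₀)
    (hf : ∀ i, ContDiffAt ℝ 1 (f i) x₀) (h : hamiltonianTwo f₀ f x₀ p < 0) :
    CanDescend (dynamics f₀ f) (controlSet m) x₀ p := by
  obtain ⟨_, ⟨g, hg, rfl⟩, hneg⟩ :=
    exists_lt_of_csInf_lt (Nonempty.image _ ⟨f₀, Or.inl (Or.inl rfl)⟩) h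
  dsimp only at hneg
  rcases hg with hg | ⟨i, rfl | rfl⟩ | ⟨j, l, rfl⟩
  · exact canDescend_of_mem_familyOne h₀ hf hg hneg
  · obtain ⟨hz, hY⟩ := eq_zero_and_inner_neg_of_indicator hneg
    refine canDescend_of_inner_fderiv_drift_ne_zero h₀ hz (hf i) fun hD => ?_
    simp [VectorField.lieBracket, hz, hD] at hY
  · obtain ⟨hz, hY⟩ := eq_zero_and_inner_neg_of_indicator hneg
    refine canDescend_of_inner_fderiv_drift_ne_zero h₀ hz (hf i) fun hD => ?_
    simp [VectorField.lieBracket, hz, hD] at hY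
  · obtain ⟨hz, hY⟩ := eq_zero_and_inner_neg_of_indicator hneg
    exact canDescend_of_inner_lieBracket_neg h₀ hz (hf j) (hf l) hY

end Family

/-! ### Limiting gradients of semiconcave functions -/

section Semiconcave

variable {E : Type*} [NormedAddCommGroup E]

lemma exists_isMinOn_add_norm_sq [ProperSpace E] {F : E → ℝ} {c : E} {r : ℝ} (hr : 0 < r)
    (hF : ContinuousOn F (Metric.closedBall c r)) :
    ∃ u ∈ Metric.ball c r, ∃ l : ℝ,
      IsMinOn (fun z => F z + l * ‖z - c‖ ^ 2) (Metric.closedBall c r) u := by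
  have hc : c ∈ Metric.closedBall c r := Metric.mem_closedBall_self hr.le
  obtain ⟨m, -, hmin⟩ := (isCompact_closedBall c r).exists_isMinOn ⟨c, hc⟩ hF
  obtain ⟨l, hl⟩ : ∃ l : ℝ, F c - F m < l * r ^ 2 :=
    ⟨(F c - F m) / r ^ 2 + 1, by rw [add_mul, div_mul_cancel₀ _ (by positivity)]; simp [hr]⟩
  obtain ⟨u, hu, hu_min⟩ := (isCompact_closedBall c r).exists_isMinOn
    (f := fun z => F z + l * ‖z - c‖ ^ 2) ⟨c, hc⟩ (hF.add (by fun_prop))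
  refine ⟨u, ?_, l, hu_min⟩
  refine mem_ball_iff_norm.2 ((mem_closedBall_iff_norm.1 hu).lt_of_ne fun hur => ?_)
  have hc_le : F u + l * ‖u - c‖ ^ 2 ≤ F c + l * ‖c - c‖ ^ 2 := hu_min hc
  have hm_le : F m ≤ F u := hmin hu
  rw [hur, sub_self, norm_zero] at hc_le
  linarith

section NormedSpace

variable [NormedSpace ℝ E] {F : E → ℝ} {F' : E →L[ℝ] ℝ} {K : Set E} {ρ r M l : ℝ} {u z : E}

/-- Semiconcavity of `F` on `K` with constant `ρ`, in the midpoint form. The segment `[z₁, z₂]` is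
not required to lie in `K`: the notion is meant for convex sets. -/
def SemiconcaveOnWith (ρ : ℝ) (F : E → ℝ) (K : Set E) : Prop :=
  ∀ z₁ ∈ K, ∀ z₂ ∈ K, F z₁ + F z₂ - 2 * F (midpoint ℝ z₁ z₂) ≤ ρ * ‖z₁ - z₂‖ ^ 2

lemma SemiconcaveOnWith.mono {L : Set E} (h : SemiconcaveOnWith ρ F K) (hL : L ⊆ K) :
    SemiconcaveOnWith ρ F L :=
  fun z₁ h₁ z₂ h₂ => h z₁ (hL h₁) z₂ (hL h₂)

lemma nonpos_of_forall_le_two_mul_midpoint {D : E → ℝ} (hK : StarConvex ℝ u K)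
    (hD : ∀ z ∈ K, D z ≤ 2 * D (midpoint ℝ u z)) (hu : D u = 0)
    (hd : HasFDerivAt D (0 : E →L[ℝ] ℝ) u) (hz : z ∈ K) : D z ≤ 0 := by
  have hmem (k : ℕ) : u + ((2 : ℝ) ^ k)⁻¹ • (z - u) ∈ K :=
    hK.add_smul_sub_mem hz (by positivity) (inv_le_one_of_one_le₀ (one_le_pow₀ one_le_two))
  have hmid (k : ℕ) : midpoint ℝ u (u + ((2 : ℝ) ^ k)⁻¹ • (z - u))
      = u + ((2 : ℝ) ^ (k + 1))⁻¹ • (z - u) := by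
    rw [midpoint_eq_smul_add, pow_succ, mul_inv, invOf_eq_inv]
    module
  have hiter (k : ℕ) : D z ≤ 2 ^ k * D (u + ((2 : ℝ) ^ k)⁻¹ • (z - u)) := by
    induction k with
    | zero => simp
    | succ k ih =>
      calc D z ≤ 2 ^ k * D (u + ((2 : ℝ) ^ k)⁻¹ • (z - u)) := ih
        _ ≤ 2 ^ k * (2 * D (u + ((2 : ℝ) ^ (k + 1))⁻¹ • (z - u))) := by
          rw [← hmid]
          gcongr
          exact hD _ (hmem k)
        _ = _ := by ring
  have hlim := (hd.lim_real (z - u)).comp (tendsto_pow_atTop_atTop_of_one_lt one_lt_two)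
  simp only [hu, sub_zero, smul_eq_mul, zero_apply] at hlim
  exact ge_of_tendsto' hlim hiter

lemma hasFDerivAt_norm_sub_sq : HasFDerivAt (fun z : E => ‖z - u‖ ^ 2) (0 : E →L[ℝ] ℝ) u := by
  rw [hasFDerivAt_iff_isLittleO_nhds_zero]
  simpa using (Asymptotics.isLittleO_norm_pow_id (E' := E) one_lt_two)

lemma SemiconcaveOnWith.le_of_hasFDerivAt (h : SemiconcaveOnWith ρ F K) (hK : Convex ℝ K)
    (hu : u ∈ K) (hF : HasFDerivAt F F' u) (hz : z ∈ K) :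
    F z ≤ F u + F' (z - u) + 2 * ρ * ‖z - u‖ ^ 2 := by
  let D : E → ℝ := fun z => F z - F u - F' (z - u) - 2 * ρ * ‖z - u‖ ^ 2
  have hd : HasFDerivAt D (0 : E →L[ℝ] ℝ) u := by
    refine (((hF.sub_const (F u)).sub
      (F'.hasFDerivAt.comp u ((hasFDerivAt_id u).sub_const u))).sub
        (hasFDerivAt_norm_sub_sq.const_mul (2 * ρ))).congr_fderiv ?_
    simp
  have hD : ∀ z ∈ K, D z ≤ 2 * D (midpoint ℝ u z) := fun z hz => by
    have hmid : midpoint ℝ u z - u = (2 : ℝ)⁻¹ • (z - u) := by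
      rw [midpoint_sub_left, invOf_eq_inv]
    have hsc := h u hu z hz
    rw [norm_sub_rev u z] at hsc
    simp only [D, hmid, map_smul, norm_smul, smul_eq_mul, mul_pow, norm_inv, Real.norm_ofNat]
    linarith
  have := nonpos_of_forall_le_two_mul_midpoint (hK.starConvex hu) hD (by simp [D]) hd hz
  simp only [D] at this
  linarith

lemma SemiconcaveOnWith.hasFDerivAt_of_le (h : SemiconcaveOnWith ρ F K) (hK : K ∈ 𝓝 u)
    (hl : ∀ᶠ z in 𝓝 u, F u + F' (z - u) - l * ‖z - u‖ ^ 2 ≤ F z) : HasFDerivAt F F' u := by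
  have hO : (fun z => F z - F u - F' (z - u)) =O[𝓝 u] fun z => ‖z - u‖ ^ 2 := by
    have hrefl : Tendsto (fun z => u - (z - u)) (𝓝 u) (𝓝 u) :=
      Continuous.tendsto' (by fun_prop) _ _ (by simp)
    refine Asymptotics.IsBigO.of_bound (4 * |ρ| + |l|) ?_
    filter_upwards [hK, hrefl hK, hl, hrefl.eventually hl] with z hz hz' hlz hlz'
    have hmid : midpoint ℝ z (u - (z - u)) = u := by
      rw [midpoint_eq_smul_add, invOf_eq_inv]
      module
    have hsc := h z hz _ hz'
    rw [hmid, show z - (u - (z - u)) = (2 : ℝ) • (z - u) by module, norm_smul, mul_pow,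
      Real.norm_ofNat] at hsc
    rw [sub_sub_cancel_left, map_neg, norm_neg] at hlz'
    have hsq := sq_nonneg ‖z - u‖
    have hρ := mul_le_mul_of_nonneg_right (le_abs_self ρ) hsq
    have hρ' := mul_nonneg (abs_nonneg ρ) hsq
    have hl' := mul_le_mul_of_nonneg_right (le_abs_self l) hsq
    rw [Real.norm_eq_abs, Real.norm_of_nonneg hsq, abs_le]
    constructor <;> linarith
  exact .of_isLittleO (hO.trans_isLittleO
    ((Asymptotics.isLittleO_norm_pow_id one_lt_two).comp_tendsto
      (tendsto_sub_nhds_zero_iff.2 tendsto_id)))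

lemma SemiconcaveOnWith.opNorm_le [Nontrivial E]
    (h : SemiconcaveOnWith ρ F (Metric.closedBall u r)) (hr : 0 < r)
    (hM : ∀ z ∈ Metric.closedBall u r, ‖F z‖ ≤ M) (hF : HasFDerivAt F F' u) :
    ‖F'‖ ≤ (2 * M + 2 * ρ * r ^ 2) / r := by
  have hu : u ∈ Metric.closedBall u r := Metric.mem_closedBall_self hr.le
  have hle (x : E) (hx : ‖x‖ = 1) : -F' x ≤ (2 * M + 2 * ρ * r ^ 2) / r := by
    have hn : ‖u + r • x - u‖ = r := by
      rw [add_sub_cancel_left, norm_smul, hx, mul_one, Real.norm_of_nonneg hr.le]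
    have hz : u + r • x ∈ Metric.closedBall u r := mem_closedBall_iff_norm.2 hn.le
    have hF := h.le_of_hasFDerivAt (convex_closedBall u r) hu hF hz
    rw [hn, add_sub_cancel_left, map_smul, smul_eq_mul] at hF
    rw [le_div_iff₀ hr]
    linarith [(abs_le.1 (hM _ hz)).1, (abs_le.1 (hM u hu)).2]
  have hC : 0 ≤ (2 * M + 2 * ρ * r ^ 2) / r := by
    obtain ⟨x, hx⟩ := exists_norm_eq E zero_le_one
    linarith [hle x hx, hle (-x) (by rwa [norm_neg]), map_neg F' x]
  refine ContinuousLinearMap.opNorm_le_of_unit_norm hC fun x hx => ?_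
  rw [Real.norm_eq_abs, abs_le]
  have := hle (-x) (by rwa [norm_neg])
  rw [map_neg, neg_neg] at this
  exact ⟨neg_le.1 (hle x hx), this⟩

end NormedSpace

variable [InnerProductSpace ℝ E] {F : E → ℝ} {K : Set E} {ρ r : ℝ} {c x₀ : E}

lemma SemiconcaveOnWith.exists_differentiableAt [ProperSpace E] (hr : 0 < r)
    (h : SemiconcaveOnWith ρ F (Metric.closedBall c r))
    (hF : ContinuousOn F (Metric.closedBall c r)) :
    ∃ u ∈ Metric.ball c r, DifferentiableAt ℝ F u := by
  obtain ⟨u, hu, l, hmin⟩ := exists_isMinOn_add_norm_sq hr hF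
  have hK : Metric.closedBall c r ∈ 𝓝 u := Metric.closedBall_mem_nhds_of_mem hu
  refine ⟨u, hu, (h.hasFDerivAt_of_le (l := l) (F' := innerSL ℝ (-((2 * l) • (u - c)))) hK
    ?_).differentiableAt⟩
  filter_upwards [hK] with z hz
  have hz : F u + l * ‖u - c‖ ^ 2 ≤ F z + l * ‖z - c‖ ^ 2 := hmin hz
  have hsq : ‖z - c‖ ^ 2 = ‖u - c‖ ^ 2 + 2 * inner ℝ (u - c) (z - u) + ‖z - u‖ ^ 2 := by
    rw [← norm_add_sq_real, add_comm, sub_add_sub_cancel]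
  rw [innerSL_apply_apply, inner_neg_left, real_inner_smul_left]
  rw [hsq] at hz
  linarith

lemma SemiconcaveOnWith.frequently_differentiableAt [ProperSpace E] (h : SemiconcaveOnWith ρ F K)
    (hF : ContinuousOn F K) (hK : K ∈ 𝓝 x₀) : ∃ᶠ u in 𝓝 x₀, DifferentiableAt ℝ F u := by
  refine frequently_iff.2 fun {V} hV => ?_
  obtain ⟨r, hr, hrV⟩ := Metric.nhds_basis_closedBall.mem_iff.1 (inter_mem hV hK)
  obtain ⟨u, hu, hdiff⟩ := (h.mono (hrV.trans inter_subset_right)).exists_differentiableAt hr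
    (hF.mono (hrV.trans inter_subset_right))
  exact ⟨u, (hrV (Metric.ball_subset_closedBall hu)).1, hdiff⟩

lemma SemiconcaveOnWith.frequently_differentiableAt_ne [ProperSpace E] [Nontrivial E]
    (h : SemiconcaveOnWith ρ F K) (hF : ContinuousOn F K) (hK : K ∈ 𝓝 x₀) :
    ∃ᶠ u in 𝓝[≠] x₀, DifferentiableAt ℝ F u := by
  intro hnot
  have : (𝓝[≠] x₀).NeBot := Module.punctured_nhds_neBot ℝ E x₀
  obtain ⟨c, hc, hcK, hne : c ≠ x₀⟩ := ((eventually_eventually_nhdsWithin.2 hnot).and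
    ((eventually_nhdsWithin_of_eventually_nhds (eventually_mem_nhds_iff.2 hK)).and
      self_mem_nhdsWithin)).exists
  rw [isOpen_compl_singleton.nhdsWithin_eq hne] at hc
  exact h.frequently_differentiableAt hF hcK hc

lemma SemiconcaveOnWith.exists_seq_gradient [ProperSpace E] [Nontrivial E]
    (hr : 0 < r) (h : SemiconcaveOnWith ρ F (Metric.closedBall x₀ r))
    (hF : ContinuousOn F (Metric.closedBall x₀ r)) :
    ∃ (u : ℕ → E) (p : E), (∀ k, u k ∈ Metric.ball x₀ r ∧ u k ≠ x₀ ∧ DifferentiableAt ℝ F (u k)) ∧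
      Tendsto u atTop (𝓝 x₀) ∧ Tendsto (fun k => gradient F (u k)) atTop (𝓝 p) := by
  obtain ⟨M, hM⟩ := (isCompact_closedBall x₀ r).exists_bound_of_continuousOn hF
  obtain ⟨u, hu, huP⟩ := exists_seq_forall_of_frequently
    ((h.frequently_differentiableAt_ne hF (Metric.closedBall_mem_nhds x₀ hr)).and_eventually
      ((eventually_nhdsWithin_of_eventually_nhds
        (Metric.ball_mem_nhds x₀ (half_pos hr))).and self_mem_nhdsWithin))
  have hgrad (k : ℕ) : gradient F (u k) ∈
      Metric.closedBall 0 ((2 * M + 2 * ρ * (r / 2) ^ 2) / (r / 2)) := by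
    have hsub : Metric.closedBall (u k) (r / 2) ⊆ Metric.closedBall x₀ r :=
      Metric.closedBall_subset_closedBall' (by linarith [Metric.mem_ball.1 (huP k).2.1])
    rw [mem_closedBall_zero_iff, ← (InnerProductSpace.toDual ℝ E).norm_map]
    exact (h.mono hsub).opNorm_le (half_pos hr) (fun z hz => hM z (hsub hz))
      (huP k).1.hasGradientAt.hasFDerivAt
  obtain ⟨p, -, σ, hσ, hp⟩ := (isCompact_closedBall _ _).tendsto_subseq hgrad
  exact ⟨u ∘ σ, p, fun k => ⟨Metric.ball_subset_ball (half_le_self hr.le) (huP (σ k)).2.1,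
    (huP (σ k)).2.2, (huP (σ k)).1⟩,
    (hu.mono_right nhdsWithin_le_nhds).comp hσ.tendsto_atTop, hp⟩

lemma exists_mem_limitingGradients_le {n : ℕ} [Nontrivial (State n)] {Ω : Set (State n)}
    {F : State n → ℝ} {x₀ : State n} (hΩ : IsOpen Ω) (hF : IsLocallySemiconcaveOn Ω F)
    (hx₀ : x₀ ∈ Ω) :
    ∃ p ∈ limitingGradients Ω F x₀, ∃ C : ℝ,
      ∀ᶠ z in 𝓝 x₀, F z ≤ F x₀ + inner ℝ p (z - x₀) + C * ‖z - x₀‖ ^ 2 := by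
  obtain ⟨r, hr, hrΩ⟩ := Metric.nhds_basis_closedBall.mem_iff.1 (hΩ.mem_nhds hx₀)
  have hconv : Convex ℝ (Metric.closedBall x₀ r) := convex_closedBall x₀ r
  obtain ⟨hcont, ρ, -, hsc⟩ := hF _ (isCompact_closedBall x₀ r) hrΩ
  replace hsc : SemiconcaveOnWith ρ F (Metric.closedBall x₀ r) := fun z₁ h₁ z₂ h₂ =>
    hsc z₁ h₁ z₂ h₂ (hconv.segment_subset h₁ h₂)
  obtain ⟨u, p, hu, hu_lim, hp_lim⟩ := hsc.exists_seq_gradient hr hcont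
  have hu_mem (k : ℕ) : u k ∈ Metric.closedBall x₀ r := Metric.ball_subset_closedBall (hu k).1
  refine ⟨p, ⟨u, fun k => ⟨hrΩ (hu_mem k), (hu k).2⟩, hu_lim, hp_lim⟩, 2 * ρ, ?_⟩
  filter_upwards [Metric.closedBall_mem_nhds x₀ hr] with z hz
  have hF_lim : Tendsto (fun k => F (u k)) atTop (𝓝 (F x₀)) :=
    (hcont.continuousAt (Metric.closedBall_mem_nhds x₀ hr)).tendsto.comp hu_lim
  have hz_lim : Tendsto (fun k => z - u k) atTop (𝓝 (z - x₀)) := tendsto_const_nhds.sub hu_lim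
  exact ge_of_tendsto'
    ((hF_lim.add (hp_lim.inner hz_lim)).add ((hz_lim.norm.pow 2).const_mul (2 * ρ)))
    fun k => hsc.le_of_hasFDerivAt hconv (hu_mem k) (hu k).2.2.hasGradientAt.hasFDerivAt hz

end Semiconcave

/-! ### Decrease of a Lyapunov function in unit time -/

section Decrease

lemma exists_pos_forall_of_isCompact {X : Type*} [TopologicalSpace X] {K : Set X}
    {P : ℝ → X → Prop} (hK : IsCompact K) (hP : ∀ x, Antitone (P · x))
    (hloc : ∀ x ∈ K, ∃ δ > 0, ∀ᶠ z in 𝓝 x, P δ z) : ∃ δ > 0, ∀ x ∈ K, P δ x := by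
  refine hK.induction_on (p := fun S => ∃ δ > 0, ∀ x ∈ S, P δ x) ⟨1, one_pos, by simp⟩ ?_ ?_ ?_
  · rintro S S' hSS' ⟨δ, hδ, h⟩
    exact ⟨δ, hδ, fun x hx => h x (hSS' hx)⟩
  · rintro S S' ⟨δ, hδ, h⟩ ⟨δ', hδ', h'⟩
    refine ⟨min δ δ', lt_min hδ hδ', ?_⟩
    rintro x (hx | hx)
    · exact hP x (min_le_left _ _) (h x hx)
    · exact hP x (min_le_right _ _) (h' x hx)
  · intro x hx
    obtain ⟨δ, hδ, h⟩ := hloc x hx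
    exact ⟨_, mem_nhdsWithin_of_mem_nhds h, δ, hδ, fun z hz => hz⟩

section Selection

variable {X : Type*} {W δ : X → ℝ} {next : X → X}

lemma exists_selection {R : ℝ → X → X → Prop} (hR : ∀ x x', Antitone (R · x x'))
    (hW : ∀ x, 0 < W x)
    (h : ∀ a > 0, ∀ b, ∃ δ > 0, ∀ x, a ≤ W x → W x ≤ b → ∃ x', R δ x x') :
    ∃ (next : X → X) (δ : X → ℝ), (∀ x, 0 < δ x ∧ R (δ x) x (next x)) ∧
      ∀ a > 0, ∀ b, ∃ c > 0, ∀ x, a ≤ W x → W x ≤ b → c ≤ δ x := by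
  classical
  have hnat : ∀ a > 0, ∀ b, ∃ k : ℕ, ∀ x, a ≤ W x → W x ≤ b → ∃ x', R (1 / (k + 1)) x x' := by
    intro a ha b
    obtain ⟨δ, hδ, hstep⟩ := h a ha b
    obtain ⟨k, hk⟩ := exists_nat_one_div_lt hδ
    exact ⟨k, fun x hax hxb => (hstep x hax hxb).imp fun x' => hR x x' hk.le⟩
  have hex : ∀ x, ∃ k : ℕ, ∃ x', R (1 / (k + 1)) x x' := fun x =>
    (hnat (W x) (hW x) (W x)).imp fun k hk => hk x le_rfl le_rfl
  choose next hnext using fun x => Nat.find_spec (hex x)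
  refine ⟨next, fun x => 1 / (Nat.find (hex x) + 1), fun x => ⟨by positivity, hnext x⟩, ?_⟩
  intro a ha b
  obtain ⟨k, hk⟩ := hnat a ha b
  refine ⟨1 / (k + 1), by positivity, fun x hax hxb => ?_⟩
  have hle : Nat.find (hex x) ≤ k := Nat.find_min' _ (hk x hax hxb)
  beta_reduce
  gcongr

lemma exists_iterate_lt (hδ : ∀ x, 0 < δ x) (hdec : ∀ x, W (next x) ≤ W x - δ x)
    (hunif : ∀ a > 0, ∀ b, ∃ c > 0, ∀ x, a ≤ W x → W x ≤ b → c ≤ δ x) {a : ℝ} (ha : 0 < a)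
    (b : ℝ) : ∃ N : ℕ, ∀ x, W x ≤ b → W (next^[N] x) < a := by
  obtain ⟨c, hc, hcδ⟩ := hunif a ha b
  obtain ⟨N, hN⟩ := exists_nat_gt (b / c)
  rw [div_lt_iff₀ hc] at hN
  refine ⟨N, fun x hx => ?_⟩
  by_contra! hge
  have hanti : Antitone fun k => W (next^[k] x) := antitone_nat_of_succ_le fun k => by
    rw [Function.iterate_succ_apply']
    linarith [hdec (next^[k] x), hδ (next^[k] x)]
  have hle : ∀ k ≤ N, W (next^[k] x) ≤ b - k * c := by
    intro k
    induction k with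
    | zero => intro _; simpa using hx
    | succ k ih =>
      intro hk
      have hck : c ≤ δ (next^[k] x) :=
        hcδ _ (hge.trans (hanti (by omega))) ((hanti (Nat.zero_le k)).trans hx)
      rw [Function.iterate_succ_apply']
      push_cast
      linarith [hdec (next^[k] x), ih (by omega)]
  linarith [hle N le_rfl]

end Selection

variable {E C : Type*} [NormedAddCommGroup E] [NormedSpace ℝ E] [MeasurableSpace C]
  {F : E → C → E} {A : Set C} {Ω : Set E} {U : E → ℝ} {x₀ x x' : E} {δ : ℝ}

/-- Some control with values in `A` steers `x` to `x'` inside `Ω` in at most unit time. Doing so it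
decreases `U` by at least `δ`, while `U` at most doubles on the way. -/
def DecreaseStep (F : E → C → E) (A : Set C) (Ω : Set E) (U : E → ℝ) (δ : ℝ) (x x' : E) : Prop :=
  U x' ≤ U x - δ ∧ ∃ τ ≤ 1, Reach F A (Ω ∩ {z | U z ≤ 2 * U x}) τ x x'

lemma DecreaseStep.antitone (x x' : E) : Antitone (DecreaseStep F A Ω U · x x') :=
  fun _ _ hδ h => ⟨h.1.trans (by linarith), h.2⟩

lemma DecreaseStep.mem (h : DecreaseStep F A Ω U δ x x') : x' ∈ Ω := by
  obtain ⟨-, τ, -, h⟩ := h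
  exact h.mem.1

lemma DecreaseStep.exists_reach (h : DecreaseStep F A Ω U δ x x') (hδ : 0 < δ) :
    ∃ τ ∈ Ioc 0 1, Reach F A (Ω ∩ {z | U z ≤ 2 * U x}) τ x x' := by
  obtain ⟨hU, τ, hτ, h⟩ := h
  refine ⟨τ, ⟨h.pos_of_ne ?_, hτ⟩, h⟩
  rintro rfl
  linarith

lemma IsSteering.exists_decreaseStep {Φ : E → ℝ → E} (hΦ : IsSteering F A x₀ Φ) (hΩ : IsOpen Ω)
    (hU : ContinuousOn U Ω) (hx₀ : x₀ ∈ Ω) (hpos : 0 < U x₀)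
    (hlt : ∀ᶠ t in 𝓝[>] (0 : ℝ), U (Φ x₀ t) < U x₀) :
    ∃ δ > 0, ∀ᶠ x in 𝓝 x₀, ∃ x', DecreaseStep F A Ω U δ x x' := by
  have hUc : ∀ z ∈ Ω, ContinuousAt U z := fun z hz => hU.continuousAt (hΩ.mem_nhds hz)
  have hV : Ω ∩ {z | U z < 3 / 2 * U x₀} ∈ 𝓝 x₀ :=
    inter_mem (hΩ.mem_nhds hx₀) ((hUc x₀ hx₀).eventually (gt_mem_nhds (by linarith)))
  obtain ⟨t, hreach, hct, hlt⟩ :=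
    ((eventually_swap_iff.1 (hΦ.exists_reach _ hV 1 one_pos)).curry.and
      (hΦ.continuousAt.and hlt)).exists
  have hmem : Φ x₀ t ∈ Ω := by
    obtain ⟨_, _, h⟩ := hreach.self_of_nhds
    exact h.mem.1
  have hcU : ContinuousAt (fun x => U x - U (Φ x t)) x₀ :=
    (hUc x₀ hx₀).sub ((hUc _ hmem).comp (f := (Φ · t)) hct)
  obtain ⟨δ, hδ, hδlt⟩ := exists_between (sub_pos.2 hlt)
  refine ⟨δ, hδ, ?_⟩
  filter_upwards [hreach, hcU.eventually (lt_mem_nhds hδlt),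
    (hUc x₀ hx₀).eventually (lt_mem_nhds (show 3 / 4 * U x₀ < U x₀ by linarith))]
    with x ⟨τ, hτ, hx⟩ hdec hxU
  refine ⟨Φ x t, by linarith, τ, hτ, hx.mono fun z ⟨hzΩ, (hzU : U z < _)⟩ => ⟨hzΩ, ?_⟩⟩
  change U z ≤ 2 * U x
  linarith

end Decrease

lemma CanDescend.exists_decreaseStep {E C : Type*} [NormedAddCommGroup E] [InnerProductSpace ℝ E]
    [MeasurableSpace C] {F : E → C → E} {A : Set C} {Ω : Set E} {U : E → ℝ} {x₀ p : E} {c : ℝ}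
    (h : CanDescend F A x₀ p)
    (hUp : ∀ᶠ z in 𝓝 x₀, U z ≤ U x₀ + inner ℝ p (z - x₀) + c * ‖z - x₀‖ ^ 2) (hΩ : IsOpen Ω)
    (hU : ContinuousOn U Ω) (hx₀ : x₀ ∈ Ω) (hpos : 0 < U x₀) :
    ∃ δ > 0, ∀ᶠ x in 𝓝 x₀, ∃ x', DecreaseStep F A Ω U δ x x' := by
  obtain ⟨Φ, hΦ, hneg⟩ := h
  refine hΦ.exists_decreaseStep hΩ hU hx₀ hpos ?_
  filter_upwards [hneg c, hΦ.tendsto.eventually hUp] with t hneg hle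
  linarith

/-! ### Majorants of class `𝒦ℒ` -/

section Majorants

lemma integral_mem_Icc_of_length_eq_one {g : ℝ → ℝ} {a b c d : ℝ} (hab : b - a = 1)
    (hg : IntervalIntegrable g volume a b) (h : ∀ s ∈ Icc a b, g s ∈ Icc c d) :
    ∫ s in a..b, g s ∈ Icc c d := by
  have hle : a ≤ b := by linarith
  have hlow := intervalIntegral.integral_mono_on hle intervalIntegrable_const hg
    fun s hs => (h s hs).1
  have hupp := intervalIntegral.integral_mono_on hle hg intervalIntegrable_const
    fun s hs => (h s hs).2
  rw [intervalIntegral.integral_const, hab, one_smul] at hlow hupp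
  exact ⟨hlow, hupp⟩

lemma continuous_integral_comp_add {ν : ℝ → ℝ} (hν : ∀ a b, IntervalIntegrable ν volume a b)
    (a b : ℝ) : Continuous fun t => ∫ s in a..b, ν (t + s) := by
  have hprim (c : ℝ) : Continuous fun t : ℝ => ∫ s in (0 : ℝ)..t + c, ν s :=
    (intervalIntegral.continuous_primitive hν 0).comp (continuous_id.add continuous_const)
  refine ((hprim b).sub (hprim a)).congr fun t => ?_
  rw [Pi.sub_apply, intervalIntegral.integral_comp_add_left,
    intervalIntegral.integral_interval_sub_left (hν _ _) (hν _ _)]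

lemma continuousAt_integral_comp_mul {μ : ℝ → ℝ} (hμ : ∀ a b, IntervalIntegrable μ volume a b)
    (a b : ℝ) {r : ℝ} (hr : r ≠ 0) : ContinuousAt (fun r => ∫ s in a..b, μ (r * s)) r := by
  have hprim (c : ℝ) : Continuous fun r : ℝ => ∫ s in (0 : ℝ)..r * c, μ s :=
    (intervalIntegral.continuous_primitive hμ 0).comp (continuous_id.mul continuous_const)
  refine ((continuousAt_inv₀ hr).mul ((hprim b).sub (hprim a)).continuousAt).congr ?_
  filter_upwards [isOpen_ne.mem_nhds hr] with r hr
  rw [intervalIntegral.integral_comp_mul_left _ hr, smul_eq_mul, Pi.mul_apply, Pi.sub_apply,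
    intervalIntegral.integral_interval_sub_left (hμ _ _) (hμ _ _)]

lemma exists_continuous_antitone_ge {ν : ℝ → ℝ} (hν : Antitone ν) (h0 : ∀ t, 0 ≤ ν t)
    (hlim : Tendsto ν atTop (𝓝 0)) :
    ∃ η : ℝ → ℝ, Continuous η ∧ Antitone η ∧ (∀ t, 0 < η t) ∧ Tendsto η atTop (𝓝 0) ∧
      ∀ t, ν t ≤ η t := by
  set M : ℝ → ℝ := fun t => ∫ s in (-1 : ℝ)..0, ν (t + s)
  have hint (t : ℝ) : IntervalIntegrable (fun s => ν (t + s)) volume (-1) 0 :=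
    (hν.comp_monotone fun _ _ h => add_le_add_right h t).intervalIntegrable
  have hmem (t : ℝ) : M t ∈ Icc (ν t) (ν (t - 1)) :=
    integral_mem_Icc_of_length_eq_one (by norm_num) (hint t)
      fun s hs => ⟨hν (by linarith [hs.2]), hν (by linarith [hs.1])⟩
  have hM_anti : Antitone M := fun a b hab =>
    intervalIntegral.integral_mono_on (by norm_num) (hint b) (hint a)
      fun s _ => hν (by linarith)
  have hM_lim : Tendsto M atTop (𝓝 0) :=
    squeeze_zero (fun t => (h0 t).trans (hmem t).1) (fun t => (hmem t).2)
      (hlim.comp (tendsto_atTop_add_const_right _ (-1) tendsto_id))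
  refine ⟨fun t => Real.exp (-t) + M t, ?_, ?_, fun t => ?_, ?_, fun t => ?_⟩
  · exact (by fun_prop : Continuous fun t : ℝ => Real.exp (-t)).add
      (continuous_integral_comp_add (fun _ _ => hν.intervalIntegrable) _ _)
  · exact Antitone.add (fun a b hab => Real.exp_le_exp.2 (neg_le_neg hab)) hM_anti
  · exact add_pos_of_pos_of_nonneg (Real.exp_pos _) ((h0 t).trans (hmem t).1)
  · simpa using Real.tendsto_exp_neg_atTop_nhds_zero.add hM_lim
  · exact (hmem t).1.trans (le_add_of_nonneg_left (Real.exp_pos _).le)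

lemma exists_continuousOn_strictMonoOn_ge {μ : ℝ → ℝ} (hμ : Monotone μ) (h0 : ∀ r, 0 ≤ μ r)
    (hlim : ∀ ε > 0, ∃ r > 0, μ r ≤ ε) :
    ∃ κ : ℝ → ℝ, ContinuousOn κ (Ici 0) ∧ StrictMonoOn κ (Ici 0) ∧ κ 0 = 0 ∧
      ∀ r, 0 ≤ r → r ≤ κ r ∧ μ r ≤ κ r := by
  set M : ℝ → ℝ := fun r => ∫ s in (1 : ℝ)..2, μ (r * s) with hM
  have hint {r : ℝ} (hr : 0 ≤ r) : IntervalIntegrable (fun s => μ (r * s)) volume 1 2 :=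
    (hμ.comp fun _ _ h => mul_le_mul_of_nonneg_left h hr).intervalIntegrable
  have hmem {r : ℝ} (hr : 0 ≤ r) : M r ∈ Icc (μ r) (μ (r * 2)) :=
    integral_mem_Icc_of_length_eq_one (by norm_num) (hint hr)
      fun s hs => ⟨hμ (le_mul_of_one_le_right hr hs.1), hμ (by gcongr; exact hs.2)⟩
  have hM_nonneg {r : ℝ} (hr : 0 ≤ r) : 0 ≤ M r := (h0 r).trans (hmem hr).1
  have hM_mono : MonotoneOn M (Ici 0) := fun a ha b hb hab =>
    intervalIntegral.integral_mono_on one_le_two (hint ha) (hint hb)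
      fun s hs => hμ (by gcongr; linarith [hs.1])
  have hμ_zero : μ 0 = 0 := le_antisymm (le_of_forall_pos_le_add fun ε hε => by
    obtain ⟨r, hr, h⟩ := hlim ε hε
    linarith [hμ hr.le]) (h0 0)
  have hM_zero : M 0 = 0 := by simp [hM, hμ_zero]
  have hM_cont : ContinuousOn M (Ici 0) := by
    intro r hr
    rcases (mem_Ici.1 hr).eq_or_lt with rfl | hr
    · rw [ContinuousWithinAt, hM_zero, Metric.tendsto_nhdsWithin_nhds]
      intro ε hε
      obtain ⟨r, hr, h⟩ := hlim (ε / 2) (half_pos hε)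
      refine ⟨r / 2, half_pos hr, fun {s} (hs : 0 ≤ s) hsr => ?_⟩
      rw [Real.dist_0_eq_abs, abs_of_nonneg hs] at hsr
      rw [Real.dist_0_eq_abs, abs_of_nonneg (hM_nonneg hs)]
      linarith [(hmem hs).2, hμ (show s * 2 ≤ r by linarith)]
    · exact (continuousAt_integral_comp_mul (fun _ _ => hμ.intervalIntegrable) 1 2
        hr.ne').continuousWithinAt
  refine ⟨fun r => r + M r, continuousOn_id.add hM_cont, ?_, by simp [hM_zero], fun r hr => ?_⟩
  · exact fun a ha b hb hab => add_lt_add_of_lt_of_le hab (hM_mono ha hb hab.le)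
  · exact ⟨le_add_of_nonneg_right (hM_nonneg hr),
      (hmem hr).1.trans (le_add_of_nonneg_left hr)⟩

lemma exists_antitone_dominating {φ : ℕ → ℝ → ℝ} (hφ : ∀ k, Antitone (φ k))
    (h0 : ∀ k t, 0 ≤ φ k t) (hlim : ∀ k, Tendsto (φ k) atTop (𝓝 0)) :
    ∃ ν : ℝ → ℝ, Antitone ν ∧ Tendsto ν atTop (𝓝 0) ∧
      ∀ k t, 0 ≤ t → φ k t ≤ 2 ^ k * (1 + φ k 0) * ν t := by
  set g : ℕ → ℝ → ℝ := fun k t => (1 / 2) ^ k * min 1 (φ k t) with hg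
  have hg_nonneg (k : ℕ) (t : ℝ) : 0 ≤ g k t :=
    mul_nonneg (by positivity) (le_min zero_le_one (h0 k t))
  have hg_le (k : ℕ) (t : ℝ) : g k t ≤ (1 / 2) ^ k :=
    mul_le_of_le_one_right (by positivity) (min_le_left _ _)
  have hsum (t : ℝ) : Summable fun k => g k t :=
    .of_nonneg_of_le (hg_nonneg · t) (hg_le · t) summable_geometric_two
  refine ⟨fun t => ∑' k, g k t, fun a b hab => ?_, ?_, fun k t ht => ?_⟩
  · refine (hsum b).tsum_le_tsum (fun k => ?_) (hsum a)
    have := hφ k hab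
    simp only [hg]
    gcongr
  · have hg_lim (k : ℕ) : Tendsto (g k) atTop (𝓝 0) := by
      simpa using ((tendsto_const_nhds (x := (1 : ℝ))).min (hlim k)).const_mul ((1 / 2) ^ k)
    rw [← tsum_zero (β := ℕ)]
    exact tendsto_tsum_of_dominated_convergence summable_geometric_two hg_lim
      (.of_forall fun t k => (Real.norm_of_nonneg (hg_nonneg k t)).trans_le (hg_le k t))
  · have hmin : φ k t ≤ (1 + φ k 0) * min 1 (φ k t) := by
      rcases min_cases 1 (φ k t) with ⟨h, -⟩ | ⟨h, -⟩ <;> rw [h] <;>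
        nlinarith [hφ k ht, h0 k t, h0 k 0]
    calc φ k t ≤ (1 + φ k 0) * min 1 (φ k t) := hmin
      _ = 2 ^ k * (1 + φ k 0) * g k t := by
        simp only [hg, one_div, inv_pow]
        field_simp
      _ ≤ 2 ^ k * (1 + φ k 0) * ∑' k, g k t := by
        have := h0 k 0
        gcongr
        exact (hsum t).le_tsum k fun j _ => hg_nonneg j t

lemma isKL_mul {κ η : ℝ → ℝ} (hκ : ContinuousOn κ (Ici 0)) (hκ_mono : StrictMonoOn κ (Ici 0))
    (hκ_zero : κ 0 = 0) (hκ_le : ∀ r, 0 ≤ r → r ≤ κ r) (hη : Continuous η)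
    (hη_anti : Antitone η) (hη_pos : ∀ t, 0 < η t) (hη_lim : Tendsto η atTop (𝓝 0)) :
    IsKL fun r t => κ r * η t where
  continuousOn := (hκ.comp continuousOn_fst fun _ hq => hq.1).mul
    (hη.comp continuous_snd).continuousOn
  nonneg r t hr _ := mul_nonneg (hr.trans (hκ_le r hr)) (hη_pos t).le
  zero_left _ _ := by rw [hκ_zero, zero_mul]
  strictMonoOn t _ _ ha _ hb hab := mul_lt_mul_of_pos_right (hκ_mono ha hb hab) (hη_pos t)
  unbounded t _ := by
    rintro ⟨M, hM⟩
    have hr : 0 ≤ (|M| + 1) / η t := div_nonneg (by positivity) (hη_pos t).le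
    have hκM : κ ((|M| + 1) / η t) * η t ≤ M := hM ⟨_, hr, rfl⟩
    have := (div_le_iff₀ (hη_pos t)).1 (hκ_le _ hr)
    linarith [le_abs_self M]
  antitoneOn r hr _ _ _ _ hab := mul_le_mul_of_nonneg_left (hη_anti hab) (hr.trans (hκ_le r hr))
  tendsto_zero r _ := by simpa using hη_lim.const_mul (κ r)

/- Bounding `ψ r t` both by `ψ r 0` and by `C ⌈r⌉ * ν t`, the geometric mean
`√(ψ r 0 * C ⌈r⌉) * √(ν t)` of the two separates the variables. -/
lemma exists_isKL_ge {ψ : ℝ → ℝ → ℝ} (h0 : ∀ r t, 0 ≤ ψ r t)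
    (hmono : ∀ t, Monotone (ψ · t)) (hanti : ∀ r, Antitone (ψ r))
    (hlim : ∀ r, Tendsto (ψ r) atTop (𝓝 0)) (hsmall : ∀ ε > 0, ∃ r > 0, ψ r 0 ≤ ε) :
    ∃ β : ℝ → ℝ → ℝ, IsKL β ∧ ∀ r t, 0 ≤ r → 0 ≤ t → ψ r t ≤ β r t := by
  obtain ⟨ν, hν, hν_lim, hν_le⟩ := exists_antitone_dominating (φ := fun k => ψ k)
    (fun k => hanti k) (fun k => h0 k) fun k => hlim k
  set C : ℕ → ℝ := fun k => 2 ^ k * (1 + ψ k 0)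
  have hC0 (k : ℕ) : 0 < C k := mul_pos (by positivity) (by linarith [h0 k 0])
  have hC_mono : Monotone C := fun a b hab =>
    mul_le_mul (pow_le_pow_right₀ one_le_two hab)
      (add_le_add_right (hmono 0 (Nat.cast_le.2 hab)) 1) (by linarith [h0 a 0]) (by positivity)
  set μ : ℝ → ℝ := fun r => √(ψ r 0 * C ⌈r⌉₊)
  have hμ_mono : Monotone μ := fun a b hab => Real.sqrt_le_sqrt <|
    mul_le_mul (hmono 0 hab) (hC_mono (Nat.ceil_mono hab)) (hC0 _).le (h0 _ _)
  have hμ_small (ε : ℝ) (hε : 0 < ε) : ∃ r > 0, μ r ≤ ε := by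
    obtain ⟨r, hr, h⟩ := hsmall (ε ^ 2 / C 1) (div_pos (by positivity) (hC0 1))
    have hψ : ψ (min r 1) 0 ≤ ε ^ 2 / C 1 := (hmono 0 (min_le_left r 1)).trans h
    have hC1 : C ⌈min r 1⌉₊ ≤ C 1 := hC_mono (Nat.ceil_le.2 (by simp))
    refine ⟨min r 1, by positivity, Real.sqrt_le_iff.2 ⟨hε.le, ?_⟩⟩
    calc _ ≤ ε ^ 2 / C 1 * C 1 := mul_le_mul hψ hC1 (hC0 _).le ((h0 _ _).trans hψ)
      _ = ε ^ 2 := div_mul_cancel₀ _ (hC0 1).ne'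
  obtain ⟨κ, hκ, hκ_mono, hκ_zero, hκ_le⟩ :=
    exists_continuousOn_strictMonoOn_ge hμ_mono (fun r => Real.sqrt_nonneg _) hμ_small
  obtain ⟨η, hη, hη_anti, hη_pos, hη_lim, hη_le⟩ :=
    exists_continuous_antitone_ge (ν := fun t => √(ν t))
      (fun a b hab => Real.sqrt_le_sqrt (hν hab)) (fun t => Real.sqrt_nonneg _)
      (by simpa using hν_lim.sqrt)
  refine ⟨_, isKL_mul hκ hκ_mono hκ_zero (fun r hr => (hκ_le r hr).1) hη hη_anti hη_pos hη_lim,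
    fun r t hr ht => ?_⟩
  have hψC : ψ r t ≤ C ⌈r⌉₊ * ν t := (hmono t (Nat.le_ceil r)).trans (hν_le _ t ht)
  calc ψ r t ≤ √((ψ r 0 * C ⌈r⌉₊) * ν t) := by
        refine Real.le_sqrt_of_sq_le ?_
        rw [sq, mul_assoc]
        exact mul_le_mul (hanti r ht) hψC (h0 r t) (h0 r 0)
    _ = μ r * √(ν t) := Real.sqrt_mul (mul_nonneg (h0 _ _) (hC0 _).le) _
    _ ≤ κ r * η t :=
        mul_le_mul (hκ_le r hr).2 (hη_le t) (Real.sqrt_nonneg _) (hr.trans (hκ_le r hr).1)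

lemma exists_isKL_bound {ι : Type*} {d : ι → ℝ} {D : ι → ℝ → ℝ} (hd : ∀ i, 0 ≤ d i)
    (hstable : ∀ ε > 0, ∃ r > 0, ∀ i, d i ≤ r → ∀ t, 0 ≤ t → D i t ≤ ε)
    (hbdd : ∀ R, ∃ M, ∀ i, d i ≤ R → ∀ t, 0 ≤ t → D i t ≤ M)
    (hattr : ∀ R, ∀ ε > 0, ∀ᶠ t in atTop, ∀ i, d i ≤ R → D i t ≤ ε) :
    ∃ β : ℝ → ℝ → ℝ, IsKL β ∧ ∀ i t, 0 ≤ t → D i t ≤ β (d i) t := by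
  set S : ℝ → ℝ → Set ℝ := fun r t =>
    insert 0 {v | ∃ i s, d i ≤ r ∧ 0 ≤ s ∧ t ≤ s ∧ v = D i s}
  have hS_bdd (r t : ℝ) : BddAbove (S r t) := by
    obtain ⟨M, hM⟩ := hbdd r
    refine BddAbove.insert 0 ⟨M, ?_⟩
    rintro _ ⟨i, s, hi, hs, -, rfl⟩
    exact hM i hi s hs
  have hψ_nonneg (r t : ℝ) : 0 ≤ sSup (S r t) := le_csSup (hS_bdd r t) (mem_insert _ _)
  have le_hψ {r t : ℝ} (i : ι) (s : ℝ) (hi : d i ≤ r) (hs : 0 ≤ s) (hts : t ≤ s) :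
      D i s ≤ sSup (S r t) := le_csSup (hS_bdd r t) (Or.inr ⟨i, s, hi, hs, hts, rfl⟩)
  have hψ_le {r t c : ℝ} (hc : 0 ≤ c) (h : ∀ i s, d i ≤ r → 0 ≤ s → t ≤ s → D i s ≤ c) :
      sSup (S r t) ≤ c := by
    refine csSup_le (insert_nonempty _ _) ?_
    rintro _ (rfl | ⟨i, s, hi, hs, hts, rfl⟩)
    exacts [hc, h i s hi hs hts]
  have hψ_lim (r : ℝ) : Tendsto (fun t => sSup (S r t)) atTop (𝓝 0) := by
    rw [Metric.tendsto_atTop]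
    intro ε hε
    obtain ⟨N, hN⟩ := eventually_atTop.1 (hattr r (ε / 2) (half_pos hε))
    refine ⟨N, fun t ht => ?_⟩
    rw [Real.dist_0_eq_abs, abs_of_nonneg (hψ_nonneg r t)]
    exact (hψ_le (half_pos hε).le fun i s hi _ hts => hN s (ht.le.trans hts) i hi).trans_lt
      (half_lt_self hε)
  obtain ⟨β, hβ, h⟩ := exists_isKL_ge (ψ := fun r t => sSup (S r t)) hψ_nonneg
    (fun t a b hab => hψ_le (hψ_nonneg _ _) fun i s hi => le_hψ i s (hi.trans hab))
    (fun r a b hab => hψ_le (hψ_nonneg _ _) fun i s hi hs hts => le_hψ i s hi hs (hab.trans hts))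
    hψ_lim
    (fun ε hε => (hstable ε hε).imp fun r ⟨hr, h⟩ =>
      ⟨hr, hψ_le hε.le fun i s hi hs _ => h i hi s hs⟩)
  exact ⟨β, hβ, fun i t ht => (le_hψ i t le_rfl ht le_rfl).trans (h _ t (hd i) ht)⟩

end Majorants

section Domination

variable {X ι : Type*} {S : Set X} {g h : X → ℝ}

/-- `g` dominates `h` on `S`: on `S`, `h` is bounded above on the sublevel sets of `g`, by an
arbitrarily small constant if the level is small. -/
def DominatesOn (S : Set X) (g h : X → ℝ) : Prop :=
  (∀ ε > 0, ∃ a > 0, ∀ x ∈ S, g x ≤ a → h x ≤ ε) ∧ ∀ b, ∃ M, ∀ x ∈ S, g x ≤ b → h x ≤ M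

lemma dominatesOn_of_isCompact [TopologicalSpace X] (hS : ∀ b, IsCompact (S ∩ {x | g x ≤ b}))
    (hg : ContinuousOn g S) (hh : ContinuousOn h S) (hpos : ∀ x ∈ S, 0 < h x → 0 < g x) :
    DominatesOn S g h := by
  refine ⟨fun ε hε => ?_, fun b => ?_⟩
  · have hmax : ∀ x ∈ S ∩ {x | g x ≤ 1}, 0 < max (g x) (ε - h x) := fun x hx => by
      rcases lt_or_ge 0 (h x) with hx' | hx'
      · exact lt_max_of_lt_left (hpos x hx.1 hx')
      · exact lt_max_of_lt_right (by linarith)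
    obtain ⟨a, ha, hmin⟩ := (hS 1).exists_forall_le'
      ((hg.sup (continuousOn_const.sub hh)).mono inter_subset_left) hmax
    refine ⟨min 1 (a / 2), by positivity, fun x hx hxa => ?_⟩
    rcases le_max_iff.1 (hmin x ⟨hx, hxa.trans (min_le_left _ _)⟩) with
      h' | (h' : a ≤ ε - h x)
    · linarith [hxa.trans (min_le_right _ _)]
    · linarith
  · obtain ⟨M, hM⟩ := (hS b).bddAbove_image (hh.mono inter_subset_left)
    exact ⟨M, fun x hx hxb => hM (mem_image_of_mem h ⟨hx, hxb⟩)⟩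

lemma exists_isKL_bound_of_dominatesOn {x : ι → X} {y : ι → ℝ → X} {C : ℝ} (hC : 0 < C)
    (hx : ∀ i, x i ∈ S) (hy : ∀ i t, 0 ≤ t → y i t ∈ S) (hh : ∀ z, 0 ≤ h z)
    (hgh : DominatesOn S g h) (hhg : DominatesOn S h g)
    (hovershoot : ∀ i t, 0 ≤ t → g (y i t) ≤ C * g (x i))
    (hattr : ∀ b, ∀ a > 0, ∀ᶠ t in atTop, ∀ i, g (x i) ≤ b → g (y i t) ≤ a) :
    ∃ β : ℝ → ℝ → ℝ, IsKL β ∧ ∀ i t, 0 ≤ t → h (y i t) ≤ β (h (x i)) t := by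
  refine exists_isKL_bound (d := fun i => h (x i)) (D := fun i t => h (y i t)) (fun i => hh _)
    (fun ε hε => ?_) (fun R => ?_) (fun R ε hε => ?_)
  · obtain ⟨a, ha, hε_of_a⟩ := hgh.1 ε hε
    obtain ⟨r, hr, ha_of_r⟩ := hhg.1 (a / C) (div_pos ha hC)
    refine ⟨r, hr, fun i hi t ht => hε_of_a _ (hy i t ht) ((hovershoot i t ht).trans ?_)⟩
    exact (le_div_iff₀' hC).1 (ha_of_r _ (hx i) hi)
  · obtain ⟨b, hb_of_R⟩ := hhg.2 R
    obtain ⟨M, hM_of_b⟩ := hgh.2 (C * b)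
    refine ⟨M, fun i hi t ht => hM_of_b _ (hy i t ht) ((hovershoot i t ht).trans ?_)⟩
    exact mul_le_mul_of_nonneg_left (hb_of_R _ (hx i) hi) hC.le
  · obtain ⟨b, hb_of_R⟩ := hhg.2 R
    obtain ⟨a, ha, hε_of_a⟩ := hgh.1 ε hε
    filter_upwards [hattr b a ha, eventually_ge_atTop 0] with t ha_of_t ht i hi
    exact hε_of_a _ (hy i t ht) (ha_of_t i (hb_of_R _ (hx i) hi))

end Domination

/-! ### Concatenation of infinitely many pieces of trajectories -/

section Glue

variable {ι α β : Type*} {t : ι → Set α} {g : ι → α → β} {b : β} {x : α}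

open Classical in
/-- The function that equals `g i` on `t i` (for pairwise disjoint sets `t i`) and `b` outside of
all the sets `t i`. -/
noncomputable def glue (t : ι → Set α) (g : ι → α → β) (b : β) (x : α) : β :=
  if h : ∃ i, x ∈ t i then g h.choose x else b

lemma glue_of_mem (ht : Pairwise (Function.onFun Disjoint t)) {i : ι} (hx : x ∈ t i) :
    glue t g b x = g i x := by
  have h : ∃ i, x ∈ t i := ⟨i, hx⟩
  have hi : h.choose = i := by
    by_contra hne
    exact disjoint_left.1 (ht hne) h.choose_spec hx
  rw [glue, dif_pos h, hi]

lemma glue_of_notMem (hx : ∀ i, x ∉ t i) : glue t g b x = b :=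
  dif_neg (not_exists.2 hx)

lemma glue_mem {A : Set β} (hg : ∀ i x, g i x ∈ A) (hb : b ∈ A) : glue t g b x ∈ A := by
  rw [glue]
  split_ifs
  exacts [hg _ _, hb]

lemma measurable_glue [Countable ι] [Nonempty ι] [MeasurableSpace α] [MeasurableSpace β]
    (ht : Pairwise (Function.onFun Disjoint t)) (ht_meas : ∀ i, MeasurableSet (t i))
    (hg : ∀ i, Measurable (g i)) : Measurable (glue t g b) := by
  classical
  obtain ⟨G, hG, hGt⟩ := exists_measurable_piecewise t ht_meas g hg
    (ht.mono fun i j h => by rw [h.inter_eq]; exact eqOn_empty _ _)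
  suffices glue t g b = (⋃ i, t i).piecewise G fun _ => b from
    this ▸ hG.piecewise (.iUnion ht_meas) measurable_const
  ext x
  by_cases hx : x ∈ ⋃ i, t i
  · obtain ⟨i, hi⟩ := mem_iUnion.1 hx
    rw [piecewise_eq_of_mem _ _ _ hx, glue_of_mem ht hi, hGt i hi]
  · rw [piecewise_eq_of_notMem _ _ _ hx, glue_of_notMem fun i hi => hx (mem_iUnion_of_mem i hi)]

end Glue

section Concatenation

variable {E C : Type*} [NormedAddCommGroup E] [NormedSpace ℝ E] [MeasurableSpace C]
  {F : E → C → E} {A : Set C} {V : ℕ → Set E} {x : ℕ → E} {s : ℕ → ℝ}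

lemma exists_concatenation (hs : StrictMono s)
    (h : ∀ k, Reach F A (V k) (s (k + 1) - s k) (x k) (x (k + 1))) (z : E) :
    ∃ (α : ℝ → C) (y : ℝ → E), Measurable α ∧ (∀ t, α t ∈ A) ∧ y (s 0) = x 0 ∧
      (∀ k, IsArc F (V k) (s k) (s (k + 1)) α y) ∧ ∀ t, (∀ k, s k ≤ t) → y t = z := by
  choose _ α y hα hαA hy hy_left hy_right using h
  set I : ℕ → Set ℝ := fun k => Ico (s k) (s (k + 1))
  have hI : Pairwise (Function.onFun Disjoint I) := hs.monotone.pairwise_disjoint_on_Ico_succ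
  have hmem (k : ℕ) : s k ∈ I k := left_mem_Ico.2 (hs k.lt_succ_self)
  set y' := glue I (fun k t => y k (t - s k)) z
  have hy'_node (k : ℕ) : y' (s k) = x k :=
    (glue_of_mem hI (hmem k)).trans (by rw [sub_self, hy_left])
  have hy'_eq (k : ℕ) : EqOn y' (fun t => y k (t - s k)) (Icc (s k) (s (k + 1))) := fun t ht => by
    rcases ht.2.eq_or_lt with rfl | hlt
    · exact (hy'_node _).trans (hy_right k).symm
    · exact glue_of_mem hI ⟨ht.1, hlt⟩
  refine ⟨glue I (fun k t => α k (t - s k)) (α 0 0), y',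
    measurable_glue hI (fun _ => measurableSet_Ico) fun k =>
      (hα k).comp (measurable_id.sub_const _),
    fun t => glue_mem (fun _ _ => hαA _ _) (hαA _ _), hy'_node 0, fun k => ?_,
    fun t ht => glue_of_notMem fun k hk => (ht (k + 1)).not_gt hk.2⟩
  have harc := (hy k).shift (s k)
  rw [add_sub_cancel] at harc
  exact harc.congr (hy'_eq k) fun t ht => glue_of_mem hI (Ioo_subset_Ico_self ht)

end Concatenation

section Trajectory

variable {n m : ℕ} {f₀ : State n → State n} {f : Fin m → State n → State n} {𝒯 : Set (State n)}

lemma isSolution_iSup_of_forall_isArc {s : ℕ → ℝ} (hs : Monotone s) (hs0 : s 0 = 0)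
    {α : ℝ → Fin m → ℝ} {y : ℝ → State n}
    (harc : ∀ k, IsArc (dynamics f₀ f) 𝒯ᶜ (s k) (s (k + 1)) α y) :
    IsSolution f₀ f 𝒯 (y 0) α (⨆ k, (s k : EReal)) y := by
  have harc' (k : ℕ) : IsArc (dynamics f₀ f) 𝒯ᶜ 0 (s k) α y :=
    hs0 ▸ IsArc.of_forall_consecutive hs harc k
  have hlt {t : ℝ} (ht : (t : EReal) < ⨆ k, (s k : EReal)) : ∃ k, t < s k := by
    simpa only [lt_iSup_iff, EReal.coe_lt_coe_iff] using ht
  refine ⟨fun t ⟨ht0, ht⟩ => ?_, fun t ht0 ht => ?_⟩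
  · obtain ⟨k, hk⟩ := hlt ht
    refine ((harc' k).1 t ⟨ht0, hk.le⟩).mono_of_mem_nhdsWithin ?_
    filter_upwards [self_mem_nhdsWithin, mem_nhdsWithin_of_mem_nhds (Iio_mem_nhds hk)]
      with r hr hrk using ⟨hr.1, le_of_lt hrk⟩
  · obtain ⟨k, hk⟩ := hlt ht
    exact (harc' k).2 t ⟨ht0, hk.le⟩

lemma exists_trajectory {V : ℕ → Set (State n)} (hV : Antitone V) (hV𝒯 : V 0 ⊆ 𝒯ᶜ)
    {x : ℕ → State n}
    (h : ∀ k, ∃ τ ∈ Ioc 0 1, Reach (dynamics f₀ f) (controlSet m) (V k) τ (x k) (x (k + 1)))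
    (z : State n) :
    ∃ (T : EReal) (y : ℝ → State n) (α : ℝ → Fin m → ℝ),
      Measurable α ∧ (∀ t, α t ∈ controlSet m) ∧ 0 < T ∧ IsSolution f₀ f 𝒯 (x 0) α T y ∧
      (∀ t : ℝ, T ≤ t → y t = z) ∧
      ∀ N : ℕ, ∃ s ∈ Icc (0 : ℝ) N, (s : EReal) < T ∧
        ∀ t : ℝ, s ≤ t → (t : EReal) < T → y t ∈ V N := by
  choose τ hτ hreach using h
  set s : ℕ → ℝ := fun k => ∑ i ∈ Finset.range k, τ i with hs_def
  have hs_succ (k : ℕ) : s (k + 1) - s k = τ k := by simp [hs_def, Finset.sum_range_succ]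
  have hs0 : s 0 = 0 := Finset.sum_range_zero τ
  have hs : StrictMono s := strictMono_nat_of_lt_succ fun k => by
    linarith [hs_succ k, (hτ k).1]
  have hsN (N : ℕ) : s N ∈ Icc (0 : ℝ) N := by
    refine ⟨Finset.sum_nonneg fun i _ => (hτ i).1.le, ?_⟩
    simpa using Finset.sum_le_card_nsmul (Finset.range N) τ 1 fun i _ => (hτ i).2
  have hsT (k : ℕ) : (s k : EReal) < ⨆ k, (s k : EReal) :=
    lt_iSup_iff.2 ⟨k + 1, EReal.coe_lt_coe_iff.2 (hs k.lt_succ_self)⟩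
  obtain ⟨α, y, hα, hαA, hy0, harc, hz⟩ :=
    exists_concatenation hs (fun k => (hs_succ k).symm ▸ hreach k) z
  refine ⟨⨆ k, (s k : EReal), y, α, hα, hαA, by simpa [hs0] using hsT 0, ?_,
    fun t ht => hz t fun k => EReal.coe_le_coe_iff.1 ((le_iSup _ k).trans ht),
    fun N => ⟨s N, hsN N, hsT N, fun t hNt ht => ?_⟩⟩
  · rw [← hy0, hs0]
    exact isSolution_iSup_of_forall_isArc hs.monotone hs0
      fun k => (harc k).mono ((hV k.zero_le).trans hV𝒯)
  · obtain ⟨j, hj⟩ : ∃ j, t < s j := by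
      simpa only [lt_iSup_iff, EReal.coe_lt_coe_iff] using ht
    have ht0 : s 0 ≤ t := (hs.monotone N.zero_le).trans hNt
    obtain ⟨k, -, hk⟩ := mem_iUnion₂.1 (Ico_subset_biUnion_Ico j s ⟨ht0, hj⟩)
    have hNk : N ≤ k := Nat.lt_succ_iff.1 (hs.lt_iff_lt.1 (hNt.trans_lt hk.2))
    exact hV hNk ((harc k).2 t (Ico_subset_Icc_self hk)).1

end Trajectory

/-! ### Degree-two control Lyapunov functions -/

section Target

lemma frontier_eq_closure_compl_inter {X : Type*} [TopologicalSpace X] {s : Set X}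
    (hs : IsClosed s) : frontier s = closure sᶜ ∩ s := by
  rw [frontier_eq_closure_inter_closure, hs.closure_eq, inter_comm]

lemma isCompact_closure_compl_inter_infDist_le {E : Type*} [NormedAddCommGroup E]
    [NormedSpace ℝ E] [FiniteDimensional ℝ E] {s : Set E} (hs : IsClosed s)
    (hfr : IsCompact (frontier s)) (hne : s.Nonempty) (R : ℝ) :
    IsCompact (closure sᶜ ∩ {x | Metric.infDist x s ≤ R}) := by
  have := FiniteDimensional.proper_real E
  refine Metric.isCompact_of_isClosed_isBounded (isClosed_closure.inter
    (isClosed_le (Metric.continuous_infDist_pt s) continuous_const)) ?_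
  refine (hfr.isBounded.cthickening (δ := R)).union hfr.isBounded |>.subset ?_
  rintro x ⟨hx, hxR⟩
  by_cases hx_mem : x ∈ s
  · exact Or.inr (frontier_eq_closure_compl_inter hs ▸ ⟨hx, hx_mem⟩)
  · obtain ⟨z, hz, hdist⟩ := exists_mem_frontier_infDist_compl_eq_dist (s := sᶜ) hx_mem
      (by simpa [nonempty_iff_ne_empty] using hne)
    rw [frontier_compl] at hz
    rw [compl_compl] at hdist
    exact Or.inl (Metric.mem_cthickening_of_dist_le x z R _ hz (hdist ▸ hxR))

lemma contDiffOn_compl_of_isCOneBounded {n : ℕ} {𝒯 : Set (State n)} (h𝒯 : IsClosed 𝒯)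
    {g : State n → State n}
    (hg : ∀ Ω : Set (State n), IsOpen Ω → Bornology.IsBounded Ω → IsCOneBounded (Ω \ 𝒯) g) :
    ContDiffOn ℝ 1 g 𝒯ᶜ := fun x hx =>
  ((hg (Metric.ball x 1) Metric.isOpen_ball Metric.isBounded_ball).1.contDiffAt
    (inter_mem (Metric.ball_mem_nhds x one_pos) (h𝒯.isOpen_compl.mem_nhds hx))).contDiffWithinAt

end Target

section ControlLyapunov

variable {n m : ℕ} {f₀ : State n → State n} {f : Fin m → State n → State n}
  {𝒯 : Set (State n)} {U : State n → ℝ}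

lemma IsDegreeTwoCLF.isClosed (hU : IsDegreeTwoCLF f₀ f 𝒯 U) : IsClosed 𝒯 :=
  frontier_subset_iff_isClosed.1 fun z hz =>
    by_contra fun hz𝒯 => (hU.pos z hz𝒯).ne' (hU.zero_frontier z hz)

lemma IsDegreeTwoCLF.isCompact_frontier (hU : IsDegreeTwoCLF f₀ f 𝒯 U) :
    IsCompact (frontier 𝒯) :=
  (hU.proper {0} isCompact_singleton (by simp)).of_isClosed_subset isClosed_frontier
    fun z hz => ⟨(frontier_eq_closure_compl_inter hU.isClosed ▸ hz).1, hU.zero_frontier z hz⟩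

lemma IsDegreeTwoCLF.pos_iff (hU : IsDegreeTwoCLF f₀ f 𝒯 U) {x : State n}
    (hx : x ∈ closure 𝒯ᶜ) : 0 < U x ↔ x ∉ 𝒯 := by
  refine ⟨fun hpos hx𝒯 => hpos.ne' (hU.zero_frontier x ?_), hU.pos x⟩
  rw [frontier_eq_closure_compl_inter hU.isClosed]
  exact ⟨hx, hx𝒯⟩

lemma IsDegreeTwoCLF.isCompact_sublevel (hU : IsDegreeTwoCLF f₀ f 𝒯 U) (b : ℝ) :
    IsCompact (closure 𝒯ᶜ ∩ {x | U x ≤ b}) := by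
  convert hU.proper (Icc 0 b) isCompact_Icc Icc_subset_Ici_self using 1
  ext x
  refine and_congr_right fun hx => ⟨fun hb => ⟨?_, hb⟩, fun h => h.2⟩
  exact le_on_closure (fun z hz => (hU.pos z hz).le) continuousOn_const hU.continuousOn hx

lemma IsDegreeTwoCLF.dominatesOn_infDist (hU : IsDegreeTwoCLF f₀ f 𝒯 U) :
    DominatesOn (closure 𝒯ᶜ) U (Metric.infDist · 𝒯) := by
  refine dominatesOn_of_isCompact hU.isCompact_sublevel hU.continuousOn
    (Metric.continuous_infDist_pt 𝒯).continuousOn fun x hx hpos => (hU.pos_iff hx).2 fun hx𝒯 => ?_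
  exact hpos.ne' (Metric.infDist_zero_of_mem hx𝒯)

lemma IsDegreeTwoCLF.infDist_dominatesOn (hU : IsDegreeTwoCLF f₀ f 𝒯 U) (hne : 𝒯.Nonempty) :
    DominatesOn (closure 𝒯ᶜ) (Metric.infDist · 𝒯) U :=
  dominatesOn_of_isCompact
    (isCompact_closure_compl_inter_infDist_le hU.isClosed hU.isCompact_frontier hne)
    (Metric.continuous_infDist_pt 𝒯).continuousOn hU.continuousOn fun _ hx hpos =>
      (hU.isClosed.notMem_iff_infDist_pos hne).1 ((hU.pos_iff hx).1 hpos)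

lemma IsDegreeTwoCLF.exists_decreaseStep_nhds (hU : IsDegreeTwoCLF f₀ f 𝒯 U) (hne : 𝒯.Nonempty)
    (h₀ : ContDiffOn ℝ 1 f₀ 𝒯ᶜ) (hf : ∀ i, ContDiffOn ℝ 1 (f i) 𝒯ᶜ) {x : State n} (hx : x ∉ 𝒯) :
    ∃ δ > 0, ∀ᶠ z in 𝓝 x, ∃ x', DecreaseStep (dynamics f₀ f) (controlSet m) 𝒯ᶜ U δ z x' := by
  have hΩ : IsOpen 𝒯ᶜ := hU.isClosed.isOpen_compl
  have hΩx : 𝒯ᶜ ∈ 𝓝 x := hΩ.mem_nhds hx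
  obtain ⟨z, hz⟩ := hne
  have : Nontrivial (State n) := ⟨x, z, fun h => hx (h ▸ hz)⟩
  obtain ⟨p, hp, c, hUp⟩ := exists_mem_limitingGradients_le hΩ hU.semiconcave hx
  exact (canDescend_of_hamiltonianTwo_neg (h₀.contDiffAt hΩx) (fun i => (hf i).contDiffAt hΩx)
    (hU.decrease x hx p hp)).exists_decreaseStep hUp hΩ (hU.continuousOn.mono subset_closure) hx
    (hU.pos x hx)

lemma IsDegreeTwoCLF.exists_decreaseStep (hU : IsDegreeTwoCLF f₀ f 𝒯 U) (hne : 𝒯.Nonempty)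
    (h₀ : ContDiffOn ℝ 1 f₀ 𝒯ᶜ) (hf : ∀ i, ContDiffOn ℝ 1 (f i) 𝒯ᶜ) {a : ℝ} (ha : 0 < a)
    (b : ℝ) :
    ∃ δ > 0, ∀ x ∉ 𝒯, a ≤ U x → U x ≤ b →
      ∃ x', DecreaseStep (dynamics f₀ f) (controlSet m) 𝒯ᶜ U δ x x' := by
  have hK := hU.proper (Icc a b) isCompact_Icc fun u hu => ha.le.trans hu.1
  obtain ⟨δ, hδ, h⟩ := exists_pos_forall_of_isCompact hK
    (P := fun δ x => ∃ x', DecreaseStep (dynamics f₀ f) (controlSet m) 𝒯ᶜ U δ x x')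
    (fun x _ _ hδ => Exists.imp fun x' => DecreaseStep.antitone x x' hδ)
    fun x ⟨hx, hax, _⟩ =>
      hU.exists_decreaseStep_nhds hne h₀ hf ((hU.pos_iff hx).1 (ha.trans_le hax))
  exact ⟨δ, hδ, fun x hx hax hxb => h x ⟨subset_closure hx, hax, hxb⟩⟩

lemma IsDegreeTwoCLF.exists_strategy (hU : IsDegreeTwoCLF f₀ f 𝒯 U) (hne : 𝒯.Nonempty)
    (h₀ : ContDiffOn ℝ 1 f₀ 𝒯ᶜ) (hf : ∀ i, ContDiffOn ℝ 1 (f i) 𝒯ᶜ) :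
    ∃ next : ↥𝒯ᶜ → ↥𝒯ᶜ,
      (∀ x : ↥𝒯ᶜ, ∃ δ > 0, DecreaseStep (dynamics f₀ f) (controlSet m) 𝒯ᶜ U δ x (next x)) ∧
      ∀ a > 0, ∀ b, ∃ N : ℕ, ∀ x : ↥𝒯ᶜ, U x ≤ b → U (next^[N] x) < a := by
  obtain ⟨next, δ, hnext, hunif⟩ := exists_selection (W := fun x : ↥𝒯ᶜ => U x)
    (R := fun δ x x' => DecreaseStep (dynamics f₀ f) (controlSet m) 𝒯ᶜ U δ x x')
    (fun x x' => DecreaseStep.antitone _ _) (fun x => hU.pos x x.2) fun a ha b => by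
      obtain ⟨δ, hδ, h⟩ := hU.exists_decreaseStep hne h₀ hf ha b
      refine ⟨δ, hδ, fun x hax hxb => ?_⟩
      obtain ⟨x', hx'⟩ := h x x.2 hax hxb
      exact ⟨⟨x', hx'.mem⟩, hx'⟩
  exact ⟨next, fun x => ⟨δ x, hnext x⟩, fun a ha b =>
    exists_iterate_lt (fun x => (hnext x).1) (fun x => (hnext x).2.1) hunif ha b⟩

end ControlLyapunov

section Stabilization

variable {n m : ℕ} {f₀ : State n → State n} {f : Fin m → State n → State n}
  {𝒯 : Set (State n)} {U : State n → ℝ}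

lemma IsDegreeTwoCLF.exists_trajectory_of_strategy (hU : IsDegreeTwoCLF f₀ f 𝒯 U)
    {next : ↥𝒯ᶜ → ↥𝒯ᶜ}
    (hnext : ∀ x : ↥𝒯ᶜ, ∃ δ > 0, DecreaseStep (dynamics f₀ f) (controlSet m) 𝒯ᶜ U δ x (next x))
    {z : State n} (hz : z ∈ frontier 𝒯) (x : ↥𝒯ᶜ) :
    ∃ (T : EReal) (y : ℝ → State n) (α : ℝ → Fin m → ℝ),
      Measurable α ∧ (∀ t, α t ∈ controlSet m) ∧ 0 < T ∧ IsSolution f₀ f 𝒯 x α T y ∧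
      (∀ t : ℝ, T ≤ t → y t = z) ∧
      ∀ N : ℕ, ∃ s ∈ Icc (0 : ℝ) N, (s : EReal) < T ∧
        ∀ t : ℝ, s ≤ t → y t ∈ closure 𝒯ᶜ ∧ U (y t) ≤ 2 * U (next^[N] x) := by
  have hanti : Antitone fun k => U (next^[k] x) := antitone_nat_of_succ_le fun k => by
    obtain ⟨δ, hδ, h⟩ := hnext (next^[k] x)
    rw [Function.iterate_succ_apply']
    linarith [h.1]
  obtain ⟨T, y, α, hα, hαA, hT, hsol, hTz, hy⟩ := exists_trajectory
    (V := fun k => 𝒯ᶜ ∩ {w | U w ≤ 2 * U (next^[k] x)}) (x := fun k => next^[k] x)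
    (fun j k hjk w hw => ⟨hw.1, hw.2.trans (mul_le_mul_of_nonneg_left (hanti hjk) zero_le_two)⟩)
    inter_subset_left
    (fun k => by
      obtain ⟨δ, hδ, h⟩ := hnext (next^[k] x)
      rw [Function.iterate_succ_apply']
      exact h.exists_reach hδ) z
  refine ⟨T, y, α, hα, hαA, hT, hsol, hTz, fun N => ?_⟩
  obtain ⟨s, hs, hsT, hys⟩ := hy N
  refine ⟨s, hs, hsT, fun t hst => ?_⟩
  rcases lt_or_ge (t : EReal) T with htT | hTt
  · exact (hys t hst htT).imp_left fun h => subset_closure h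
  · rw [hTz t hTt, hU.zero_frontier z hz]
    exact ⟨frontier_eq_closure_compl_inter hU.isClosed ▸ hz |>.1,
      mul_nonneg zero_le_two (hU.pos _ (next^[N] x).2).le⟩

lemma IsDegreeTwoCLF.exists_trajectories (hU : IsDegreeTwoCLF f₀ f 𝒯 U) (hne : 𝒯.Nonempty)
    (h₀ : ContDiffOn ℝ 1 f₀ 𝒯ᶜ) (hf : ∀ i, ContDiffOn ℝ 1 (f i) 𝒯ᶜ) :
    ∃ (T : ↥𝒯ᶜ → EReal) (y : ↥𝒯ᶜ → ℝ → State n) (α : ↥𝒯ᶜ → ℝ → Fin m → ℝ),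
      (∀ x, Measurable (α x) ∧ (∀ t, α x t ∈ controlSet m) ∧ 0 < T x ∧
        IsSolution f₀ f 𝒯 x (α x) (T x) (y x) ∧
        ∃ z ∈ frontier 𝒯, ∀ t : ℝ, T x ≤ t → y x t = z) ∧
      (∀ x t, 0 ≤ t → y x t ∈ closure 𝒯ᶜ ∧ U (y x t) ≤ 2 * U x) ∧
      ∀ b, ∀ a > 0, ∃ N : ℕ, ∀ x : ↥𝒯ᶜ, U x ≤ b →
        ∃ s ∈ Icc (0 : ℝ) N, (s : EReal) < T x ∧ ∀ t ≥ s, U (y x t) ≤ a := by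
  obtain ⟨next, hnext, hlt⟩ := hU.exists_strategy hne h₀ hf
  have hfr (x : ↥𝒯ᶜ) : (frontier 𝒯).Nonempty :=
    nonempty_frontier_iff.2 ⟨hne, (ne_univ_iff_exists_notMem 𝒯).2 ⟨x, x.2⟩⟩
  choose z hz using hfr
  choose T y α hα hαA hT hsol hTz hy using
    fun x => hU.exists_trajectory_of_strategy hnext (hz x) x
  refine ⟨T, y, α, fun x => ⟨hα x, hαA x, hT x, hsol x, z x, hz x, hTz x⟩, fun x t ht => ?_,
    fun b a ha => ?_⟩
  · obtain ⟨s, hs, -, hys⟩ := hy x 0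
    exact hys t (hs.2.trans (by simpa using ht))
  · obtain ⟨N, hN⟩ := hlt (a / 2) (half_pos ha) b
    refine ⟨N, fun x hx => ?_⟩
    obtain ⟨s, hs, hsT, hys⟩ := hy x N
    exact ⟨s, hs, hsT, fun t hst => by linarith [(hys t hst).2, hN x hx]⟩

end Stabilization

end DriftCLF

open DriftCLF in
theorem theorem5p1_general {n m : ℕ} {𝒯 : Set (State n)} {f₀ : State n → State n}
    {f : Fin m → State n → State n} {U : State n → ℝ} (h𝒯 : 𝒯.Nonempty)
    (hf₀ : ContDiffOn ℝ 1 f₀ 𝒯ᶜ) (hf : ∀ i, ContDiffOn ℝ 1 (f i) 𝒯ᶜ)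
    (hU : IsDegreeTwoCLF f₀ f 𝒯 U) : IsGAC f₀ f 𝒯 := by
  obtain ⟨T, y, α, htraj, hsublevel, hattr⟩ := hU.exists_trajectories h𝒯 hf₀ hf
  obtain ⟨β, hβ, hle⟩ := exists_isKL_bound_of_dominatesOn (x := ((↑) : ↥𝒯ᶜ → State n)) (y := y)
    two_pos (fun x => subset_closure x.2) (fun x t ht => (hsublevel x t ht).1)
    (fun _ => Metric.infDist_nonneg) hU.dominatesOn_infDist (hU.infDist_dominatesOn h𝒯)
    (fun x t ht => (hsublevel x t ht).2) fun b a ha => by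
      obtain ⟨N, hN⟩ := hattr b a ha
      filter_upwards [eventually_ge_atTop (N : ℝ)] with t ht x hx
      obtain ⟨s, hs, -, hys⟩ := hN x hx
      exact hys t (hs.2.trans ht)
  refine ⟨β, hβ, fun x hx => ?_⟩
  obtain ⟨hα, hαA, hT, hsol, hz⟩ := htraj ⟨x, hx⟩
  refine ⟨T ⟨x, hx⟩, y ⟨x, hx⟩, α ⟨x, hx⟩, ⟨hα, fun t _ => hαA t, hT, hsol, fun ε hε => ?_⟩, hz,
    hle ⟨x, hx⟩⟩
  obtain ⟨a, ha, hdist⟩ := hU.dominatesOn_infDist.1 (ε / 2) (half_pos hε)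
  obtain ⟨N, hN⟩ := hattr (U x) a ha
  obtain ⟨s, hs, hsT, hys⟩ := hN ⟨x, hx⟩ le_rfl
  exact ⟨s, hs.1, hsT, fun t hst _ => (hdist _ (hsublevel _ t (hs.1.trans hst.le)).1
    (hys t hst.le)).trans_lt (half_lt_self hε)⟩

theorem theorem5p1 {n m : ℕ} (𝒯 : Set (DriftCLF.State n))
    (h𝒯_closed : IsClosed 𝒯) (h𝒯_frontier : IsCompact (frontier 𝒯)) (h𝒯_nonempty : 𝒯.Nonempty)
    (f₀ : DriftCLF.State n → DriftCLF.State n)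
    (f : Fin m → DriftCLF.State n → DriftCLF.State n)
    (hf₀ : ∀ Ω : Set (DriftCLF.State n), IsOpen Ω → Bornology.IsBounded Ω →
      DriftCLF.IsCOneBounded (Ω \ 𝒯) f₀)
    (hf : ∀ i : Fin m, ∀ Ω : Set (DriftCLF.State n), IsOpen Ω → Bornology.IsBounded Ω →
      DriftCLF.IsCOneBounded (Ω \ 𝒯) (f i))
    (hU : ∃ U : DriftCLF.State n → ℝ, DriftCLF.IsDegreeTwoCLF f₀ f 𝒯 U) :
    DriftCLF.IsGAC f₀ f 𝒯 := by
  obtain ⟨U, hU⟩ := hU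
  exact theorem5p1_general h𝒯_nonempty (DriftCLF.contDiffOn_compl_of_isCOneBounded h𝒯_closed hf₀)
    (fun i => DriftCLF.contDiffOn_compl_of_isCOneBounded h𝒯_closed (hf i)) hU
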